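/- Let $n\ge 0$. A multi-port finite state machine (FSM) $M$ with ports $1,\dots,n$ has a finite set of states $S$, an initial state $s_0\in S$, pairwise disjoint finite sets $I_p$ of inputs and $O_p$ of outputs for each port $p$, and a transition relation $h$: writing $I=\bigcup_p I_p$ and $O=\prod_p (O_p\cup\{-\})$ (where $-$ is null output), if $(s',y)\in h(s,x)$ with $s,s'\in S$, $x\in I$, $y=(z_1,\dots,z_n)\in O$, then on receiving $x$ in state $s$ the machine can move to $s'$ and send $z_p$ to each port $p$ with $z_p\neq -$. Let $L(M)$ be the set of labels (global traces) $x_1/y_1\cdots x_m/y_m$ of the finite paths of $M$ starting in $s_0$, and let $L_k(M)$ be the set of those with $m\le k$. The projection $\pi_p(\sigma)$ of a global trace $\sigma$ at port $p$ is the sequence of the inputs and non-null outputs of $\sigma$ that occur at $p$, the input of a step preceding its output; write $\sigma\sim\sigma'$ if $\pi_p(\sigma)=\pi_p(\sigma')$ for all ports $p$. For FSMs $N,M$ with the same ports and the same input and output alphabets, $N\sqsubseteq_s^k M$ ($N$ strongly $k$-conforms to $M$) means that for every $\sigma\in L_k(N)$ there is $\sigma'\in L(M)$ with $\sigma'\sim\sigma$.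 **Theorem.** Let $K$ and $B$ be fixed natural numbers. The following problem can be solved in polynomial time: given $k\le K$, and FSMs $N$ and $M$ with the same $n\le B$ ports and the same input and output alphabets, does $N\sqsubseteq_s^k M$ hold? That is, there are a (multi-stack) Turing machine and a polynomial, depending only on $K$ and $B$, such that on every instance, encoded as a word over a fixed finite alphabet by writing $k$, $n$, the sizes of the alphabets and, for each FSM, the number of its states, its initial state and the list of its transitions (in any order, all numbers in binary), the machine halts with the correct yes/no answer after a number of steps that is at most the polynomial evaluated at the length of the word. -/

import Mathlib

/-!
Multi-port finite state machines, strong `k`-conformance in the distributed test architecture, and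
the corresponding decision problem together with its encoding by words over a finite alphabet.
Polynomial time is Mathlib's `Turing.TM2ComputableInPolyTime` (multi-stack Turing machines).
-/

namespace MultiPort

/-- The inputs of a system with ports `Fin n`: an input is an element of exactly one `I p`,
the set of inputs that can be received at port `p`. -/
abbrev Input {n : ℕ} (I : Fin n → Type) : Type := Σ p : Fin n, I p

/-- The outputs: tuples `(z₁, …, zₙ)` with `z_p ∈ O_p ∪ {-}`; the null output `-` is `none`. -/
abbrev Output {n : ℕ} (O : Fin n → Type) : Type := (p : Fin n) → Option (O p)

/-- Global traces `x₁/y₁ … x_k/y_k`. -/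
abbrev Trace {n : ℕ} (I O : Fin n → Type) : Type := List (Input I × Output O)

/-- A (nondeterministic) multi-port finite state machine with ports `Fin n`, inputs `I p` and
outputs `O p` at port `p`. -/
structure FSM {n : ℕ} (I O : Fin n → Type) where
  /-- the states -/
  State : Type
  /-- there are finitely many states -/
  finite_state : Finite State
  /-- the initial state -/
  init : State
  /-- the transition relation: `(s', y) ∈ h s x` if the machine, receiving the input `x` in
  state `s`, can move to `s'` and send the output `y` -/
  h : State → Input I → Set (State × Output O)

variable {n : ℕ} {I O : Fin n → Type}

/-- `M.Path s σ s'`: there is a path of `M` with starting state `s`, label `σ` and ending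
state `s'`. -/
inductive FSM.Path (M : FSM I O) : M.State → Trace I O → M.State → Prop
  | nil (s : M.State) : FSM.Path M s [] s
  | cons {s s' s'' : M.State} {x : Input I} {y : Output O} {σ : Trace I O} :
      (s', y) ∈ M.h s x → FSM.Path M s' σ s'' → FSM.Path M s ((x, y) :: σ) s''

/-- `L(M)`: the labels of the paths of `M` that start in the initial state. -/
def FSM.lang (M : FSM I O) : Set (Trace I O) :=
  {σ | ∃ s, M.Path M.init σ s}

/-- `L_k(M)`: the global traces of `M` that have at most `k` inputs. -/
def FSM.langUpTo (M : FSM I O) (k : ℕ) : Set (Trace I O) :=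
  {σ | σ ∈ M.lang ∧ σ.length ≤ k}

/-- The contribution of an input to the local trace at port `p`. -/
def inputAt (p : Fin n) (x : Input I) : List (I p ⊕ O p) :=
  if h : x.1 = p then [Sum.inl (h ▸ x.2)] else []

/-- The contribution of an output tuple to the local trace at port `p`. -/
def outputAt (p : Fin n) (y : Output O) : List (I p ⊕ O p) :=
  match y p with
  | none => []
  | some z => [Sum.inr z]

/-- The projection `π_p(σ)`: the sequence of observations that `σ` produces at port `p`. -/
def proj (p : Fin n) : Trace I O → List (I p ⊕ O p)
  | [] => []
  | (x, y) :: σ => inputAt p x ++ (outputAt p y ++ proj p σ)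

/-- `σ ∼ σ'`: the two global traces have the same projection at every port. -/
def Indist (σ σ' : Trace I O) : Prop :=
  ∀ p : Fin n, proj p σ = proj p σ'

/-- `N ⊑ₛᵏ M`: `N` strongly `k`-conforms to `M`. -/
def StronglyConformsUpTo (k : ℕ) (N M : FSM I O) : Prop :=
  ∀ σ ∈ N.langUpTo k, ∃ σ' ∈ M.lang, Indist σ' σ

/-- A finite description of an FSM with `a p` inputs and `b p` outputs at each port `p`: states,
inputs and outputs are numbered, and the transitions `(s, s', x/y)` are listed (in any order). -/
structure FSMDesc {n : ℕ} (a b : Fin n → ℕ) where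
  /-- the number of states -/
  numStates : ℕ
  /-- the initial state -/
  init : Fin numStates
  /-- the transitions `(s, s', x/y)` -/
  trans : List (Fin numStates × Fin numStates ×
    Input (fun p => Fin (a p)) × Output (fun p => Fin (b p)))

/-- The FSM given by a description. -/
def FSMDesc.toFSM {n : ℕ} {a b : Fin n → ℕ} (D : FSMDesc a b) :
    FSM (fun p => Fin (a p)) (fun p => Fin (b p)) where
  State := Fin D.numStates
  finite_state := inferInstance
  init := D.init
  h s x := {r | (s, r.1, x, r.2) ∈ D.trans}

/-- An instance of the bounded conformance problem: a length bound `k ≤ K`, a number `n ≤ B` of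
ports, the sizes of the input and output alphabets at the ports, and two FSMs `N` and `M`
over these alphabets. -/
structure Instance (K B : ℕ) where
  /-- the bound on the number of inputs -/
  k : ℕ
  k_le : k ≤ K
  /-- the number of ports -/
  n : ℕ
  n_le : n ≤ B
  /-- the number of inputs at each port -/
  a : Fin n → ℕ
  /-- the number of outputs at each port -/
  b : Fin n → ℕ
  /-- the implementation -/
  N : FSMDesc a b
  /-- the specification -/
  M : FSMDesc a b

/-- The question asked about an instance: does `N ⊑ₛᵏ M` hold? -/
def Instance.Conforms {K B : ℕ} (q : Instance K B) : Prop :=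
  StronglyConformsUpTo q.k q.N.toFSM q.M.toFSM

open Classical in
/-- The correct answer to an instance. -/
noncomputable def Instance.answer {K B : ℕ} (q : Instance K B) : Bool :=
  decide q.Conforms

section Encoding

open Computability

/-- A number in binary, terminated by a comma. -/
def encNat (m : ℕ) : List Γ' := (encodeNat m).map Γ'.bit ++ [Γ'.comma]

/-- An output at one port: its number, or a blank for the null output. -/
def encOut {m : ℕ} : Option (Fin m) → List Γ'
  | none => [Γ'.blank, Γ'.comma]
  | some z => encNat z

/-- A transition `(s, s', x/y)`: the two states, the port and the number of the input, and the
outputs at the ports in order. -/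
def encTrans {n : ℕ} {a b : Fin n → ℕ} {m : ℕ}
    (t : Fin m × Fin m × Input (fun p => Fin (a p)) × Output (fun p => Fin (b p))) : List Γ' :=
  [Γ'.bra] ++ encNat t.1 ++ encNat t.2.1 ++ encNat t.2.2.1.1 ++ encNat t.2.2.1.2 ++
    (List.finRange n).flatMap (fun p => encOut (t.2.2.2 p)) ++ [Γ'.ket]

/-- An FSM: the number of states, the initial state and the list of transitions. -/
def FSMDesc.encode {n : ℕ} {a b : Fin n → ℕ} (D : FSMDesc a b) : List Γ' :=
  [Γ'.bra] ++ encNat D.numStates ++ encNat D.init ++ D.trans.flatMap encTrans ++ [Γ'.ket]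

/-- An instance: `k`, the number of ports, the sizes of the alphabets, and the two FSMs. -/
def Instance.encode {K B : ℕ} (q : Instance K B) : List Γ' :=
  encNat q.k ++ encNat q.n ++
    (List.finRange q.n).flatMap (fun p => encNat (q.a p) ++ encNat (q.b p)) ++
    q.N.encode ++ q.M.encode

end Encoding

end MultiPort

/-!
With `K` and `B` fixed, bounded conformance is a first-order property of the encoding, and
first-order properties of words can be checked in polynomial time.

Indistinguishable traces contain the same number of inputs, so `N` strongly `k`-conforms to `M` iff
for every `m ≤ k` and every path of `N` with `m` transitions there is a path of `M` with `m`
transitions that has the same projections (`MultiPort.stronglyConforms_iff`). A transition is given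
by the position in the encoding at which it is listed; so for `m ≤ K` this is a statement with `2m`
quantifiers over positions. What remains is to compare binary numbers that are written at given
positions, where the projections at a port are compared by a case distinction on which of the `2m`
inputs and outputs on either side occur at this port (`MultiPort.sameSeq`). The values of `k` and
`n` are also bounded, so a finite disjunction over them makes the number of quantifiers and the
ports explicit (`MultiPort.conforms`, `MultiPort.holds_conforms`).

The formulas (`StackProgram.Fm`) have variables for positions, represented by the suffixes of the
word that begin there, and atoms that scan two suffixes in parallel. They are evaluated by a machine
with one two-way reading head for each variable that is in scope, where a head is a pair of stacks;
a quantifier moves its head over the whole word, so that the time is multiplied by the length of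
the word for each nested quantifier (`StackProgram.evaluates_prog`). The machine is written in a
small structured language, which is compiled to `TM2` machines step by step
(`StackProgram.Runs.reach`). Together this gives `StackProgram.polyTime_of_formula`: every decision
problem that is described by a formula about the encoding can be solved in polynomial time.
-/

/-! ### A structured programming language for stack machines -/

namespace StackProgram

open Turing

section Language

variable {K : Type} {Γ : K → Type} {σ : Type}

/-- The memory of a stack machine: its finite internal state and the contents of its stacks. -/
abbrev Mem (Γ : K → Type) (σ : Type) : Type := σ × ∀ k, List (Γ k)

/-- The elementary instructions: the `TM2` statements without control flow. -/
inductive Prim (Γ : K → Type) (σ : Type) where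
  | push (k : K) (f : σ → Γ k) : Prim Γ σ
  | peek (k : K) (f : σ → Option (Γ k) → σ) : Prim Γ σ
  | pop (k : K) (f : σ → Option (Γ k) → σ) : Prim Γ σ
  | load (f : σ → σ) : Prim Γ σ

/-- Programs with structured control flow: `when` is a conditional without alternative, `loop` a
while loop. Tests depend on the internal state only. A program is compiled to a fragment of a `TM2`
machine by `Cmd.code`. -/
inductive Cmd (Γ : K → Type) (σ : Type) where
  | prim (p : Prim Γ σ) : Cmd Γ σ
  | seq (c d : Cmd Γ σ) : Cmd Γ σ
  | when (b : σ → Bool) (c : Cmd Γ σ) : Cmd Γ σ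
  | loop (b : σ → Bool) (c : Cmd Γ σ) : Cmd Γ σ

/-- The statement that executes an instruction and continues with `q`. -/
def Prim.stmt {Λ : Type} (q : TM2.Stmt Γ Λ σ) : Prim Γ σ → TM2.Stmt Γ Λ σ
  | .push k f => .push k f q
  | .peek k f => .peek k f q
  | .pop k f => .pop k f q
  | .load f => .load f q

variable [DecidableEq K]

/-- The effect of an instruction on the memory. -/
def Prim.run : Prim Γ σ → Mem Γ σ → Mem Γ σ
  | .push k f, s => (s.1, Function.update s.2 k (f s.1 :: s.2 k))
  | .peek k f, s => (f s.1 (s.2 k).head?, s.2)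
  | .pop k f, s => (f s.1 (s.2 k).head?, Function.update s.2 k (s.2 k).tail)
  | .load f, s => (f s.1, s.2)

theorem Prim.stepAux_stmt {Λ : Type} (p : Prim Γ σ) (q : TM2.Stmt Γ Λ σ) (s : Mem Γ σ) :
    TM2.stepAux (p.stmt q) s.1 s.2 = TM2.stepAux q (p.run s).1 (p.run s).2 := by
  cases p <;> rfl

/-- `Runs c s s' t`: started with memory `s`, the program `c` ends with memory `s'` after at most
`t` steps. -/
inductive Runs : Cmd Γ σ → Mem Γ σ → Mem Γ σ → ℕ → Prop
  | prim (p : Prim Γ σ) (s : Mem Γ σ) : Runs (.prim p) s (p.run s) 1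
  | seq {c d : Cmd Γ σ} {s s' s'' : Mem Γ σ} {t t' : ℕ} :
      Runs c s s' t → Runs d s' s'' t' → Runs (.seq c d) s s'' (t + t')
  | when_false {b : σ → Bool} {c : Cmd Γ σ} {s : Mem Γ σ} :
      b s.1 = false → Runs (.when b c) s s 1
  | when_true {b : σ → Bool} {c : Cmd Γ σ} {s s' : Mem Γ σ} {t : ℕ} :
      b s.1 = true → Runs c s s' t → Runs (.when b c) s s' (t + 1)
  | loop_false {b : σ → Bool} {c : Cmd Γ σ} {s : Mem Γ σ} :
      b s.1 = false → Runs (.loop b c) s s 1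
  | loop_true {b : σ → Bool} {c : Cmd Γ σ} {s s' s'' : Mem Γ σ} {t t' : ℕ} :
      b s.1 = true → Runs c s s' t → Runs (.loop b c) s' s'' t' →
        Runs (.loop b c) s s'' (t + t' + 1)
  | mono {c : Cmd Γ σ} {s s' : Mem Γ σ} {t t' : ℕ} : Runs c s s' t → t ≤ t' → Runs c s s' t'

end Language

/-! ### Compilation to `TM2` machines -/

section Compile

variable {K : Type} {Γ : K → Type} {σ : Type}

/-- The labels used by the compiled program: one for each instruction and for each test. -/
def Cmd.Lab : Cmd Γ σ → Type
  | .prim _ => Unit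
  | .seq c d => c.Lab ⊕ d.Lab
  | .when _ c => Option c.Lab
  | .loop _ c => Option c.Lab

/-- There are finitely many labels. -/
@[reducible]
noncomputable def Cmd.fintypeLab : (c : Cmd Γ σ) → Fintype c.Lab
  | .prim _ => inferInstanceAs (Fintype Unit)
  | .seq c d =>
    haveI := c.fintypeLab
    haveI := d.fintypeLab
    inferInstanceAs (Fintype (c.Lab ⊕ d.Lab))
  | .when _ c =>
    haveI := c.fintypeLab
    inferInstanceAs (Fintype (Option c.Lab))
  | .loop _ c =>
    haveI := c.fintypeLab
    inferInstanceAs (Fintype (Option c.Lab))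

/-- The label at which the compiled program is entered. -/
def Cmd.entry : (c : Cmd Γ σ) → c.Lab
  | .prim _ => ()
  | .seq c _ => Sum.inl c.entry
  | .when _ _ => none
  | .loop _ _ => none

/-- The statements of the compiled program, as part of a machine with labels `Λ`. The labels of
the program are embedded by `i`; when it ends, the control passes to the label `e`. -/
def Cmd.code {Λ : Type} : (c : Cmd Γ σ) → (i : c.Lab → Λ) → (e : Λ) → c.Lab → TM2.Stmt Γ Λ σ
  | .prim p, _, e, _ => p.stmt (.goto fun _ => e)
  | .seq c d, i, _, Sum.inl l => c.code (fun l => i (Sum.inl l)) (i (Sum.inr d.entry)) l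
  | .seq _ d, i, e, Sum.inr l => d.code (fun l => i (Sum.inr l)) e l
  | .when b c, i, e, none => .branch b (.goto fun _ => i (some c.entry)) (.goto fun _ => e)
  | .when _ c, i, e, some l => c.code (fun l => i (some l)) e l
  | .loop b c, i, e, none => .branch b (.goto fun _ => i (some c.entry)) (.goto fun _ => e)
  | .loop _ c, i, _, some l => c.code (fun l => i (some l)) (i none) l

variable [DecidableEq K]

/-- `Reach M c c' t`: the machine `M` gets from `c` to `c'` in at most `t` steps. -/
def Reach {Λ : Type} (M : Λ → TM2.Stmt Γ Λ σ) (c c' : TM2.Cfg Γ Λ σ) (t : ℕ) : Prop :=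
  ∃ m ≤ t, (flip bind (TM2.step M))^[m] (some c) = some c'

theorem Reach.trans {Λ : Type} {M : Λ → TM2.Stmt Γ Λ σ} {c₁ c₂ c₃ : TM2.Cfg Γ Λ σ} {t t' : ℕ}
    (h : Reach M c₁ c₂ t) (h' : Reach M c₂ c₃ t') : Reach M c₁ c₃ (t + t') := by
  obtain ⟨m, hm, e⟩ := h
  obtain ⟨m', hm', e'⟩ := h'
  exact ⟨m' + m, by omega, by rw [Function.iterate_add_apply, e, e']⟩

theorem Reach.mono {Λ : Type} {M : Λ → TM2.Stmt Γ Λ σ} {c₁ c₂ : TM2.Cfg Γ Λ σ} {t t' : ℕ}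
    (h : Reach M c₁ c₂ t) (ht : t ≤ t') : Reach M c₁ c₂ t' :=
  let ⟨m, hm, e⟩ := h
  ⟨m, hm.trans ht, e⟩

theorem Reach.single {Λ : Type} {M : Λ → TM2.Stmt Γ Λ σ} {l : Λ} {s : Mem Γ σ}
    {c' : TM2.Cfg Γ Λ σ} (h : TM2.stepAux (M l) s.1 s.2 = c') :
    Reach M ⟨some l, s.1, s.2⟩ c' 1 :=
  ⟨1, le_rfl, by subst h; rfl⟩

/-- The compiled program behaves as specified by `Runs`, in every machine `M` that contains it. -/
theorem Runs.reach {Λ : Type} {M : Λ → TM2.Stmt Γ Λ σ} {c : Cmd Γ σ} {s s' : Mem Γ σ} {t : ℕ}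
    (h : Runs c s s' t) : ∀ (i : c.Lab → Λ) (e : Λ), (∀ l, M (i l) = c.code i e l) →
      Reach M ⟨some (i c.entry), s.1, s.2⟩ ⟨some e, s'.1, s'.2⟩ t := by
  induction h with
  | prim p s =>
    intro i e hM
    refine Reach.single ?_
    rw [hM, Cmd.code, Prim.stepAux_stmt]
    rfl
  | @seq c d _ _ _ _ _ _ _ ih ih' =>
    intro i e hM
    exact (ih (fun l => i (Sum.inl l)) (i (Sum.inr d.entry)) fun l => hM (Sum.inl l)).trans
      (ih' (fun l => i (Sum.inr l)) e fun l => hM (Sum.inr l))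
  | when_false hb =>
    intro i e hM
    refine Reach.single ?_
    rw [hM, Cmd.entry, Cmd.code, TM2.stepAux, hb]
    rfl
  | @when_true b c s _ _ hb _ ih =>
    intro i e hM
    have h₁ : Reach M ⟨some (i (Cmd.when b c).entry), s.1, s.2⟩
        ⟨some (i (some c.entry)), s.1, s.2⟩ 1 := by
      refine Reach.single ?_
      rw [hM, Cmd.entry, Cmd.code, TM2.stepAux, hb]
      rfl
    exact (h₁.trans (ih (fun l => i (some l)) e fun l => hM (some l))).mono (by omega)
  | loop_false hb =>
    intro i e hM
    refine Reach.single ?_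
    rw [hM, Cmd.entry, Cmd.code, TM2.stepAux, hb]
    rfl
  | @loop_true b c s _ _ _ _ hb _ _ ih ih' =>
    intro i e hM
    have h₁ : Reach M ⟨some (i (Cmd.loop b c).entry), s.1, s.2⟩
        ⟨some (i (some c.entry)), s.1, s.2⟩ 1 := by
      refine Reach.single ?_
      rw [hM, Cmd.entry, Cmd.code, TM2.stepAux, hb]
      rfl
    exact ((h₁.trans (ih (fun l => i (some l)) (i none) fun l => hM (some l))).trans
      (ih' i e hM)).mono (by omega)
  | mono _ ht ih =>
    intro i e hM
    exact (ih i e hM).mono ht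

/-- The machine that executes the program `c` and halts. -/
def Cmd.machine (c : Cmd Γ σ) : Option c.Lab → TM2.Stmt Γ (Option c.Lab) σ
  | none => .halt
  | some l => c.code some none l

theorem Runs.reach_machine {c : Cmd Γ σ} {s s' : Mem Γ σ} {t : ℕ} (h : Runs c s s' t) :
    Reach c.machine ⟨some (some c.entry), s.1, s.2⟩ ⟨none, s'.1, s'.2⟩ (t + 1) :=
  (h.reach some none fun _ => rfl).trans (Reach.single rfl)

end Compile

end StackProgram

/-! ### A machine with several two-way reading heads on the input word -/

namespace StackProgram

/-- The stacks of the machine with heads `Fin H`: the input, the output, a counter, and, for each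
head, the part of the word to the left of the head (reversed) and the part to the right of it. -/
inductive Stk (H : ℕ) where
  | inp : Stk H
  | out : Stk H
  | ctr : Stk H
  | left (h : Fin H) : Stk H
  | right (h : Fin H) : Stk H
  deriving DecidableEq, Fintype

/-- The alphabets of the stacks. -/
@[reducible]
def Alph (A : Type) {H : ℕ} : Stk H → Type
  | .out => Bool
  | _ => A

/-- The registers of the machine: a Boolean flag and two symbols. -/
abbrev Reg (A : Type) : Type := Bool × Option A × Option A

variable {A : Type} {H : ℕ}

/-- The contents of the stacks. -/
abbrev Stacks (A : Type) (H : ℕ) : Type := ∀ k : Stk H, List (Alph A k)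

/-- The part of the word to the right of the head `h`. -/
def Stacks.suf (S : Stacks A H) (h : Fin H) : List A := S (.right h)

/-- The part of the word to the left of the head `h`, reversed. -/
def Stacks.pre (S : Stacks A H) (h : Fin H) : List A := S (.left h)

/-- All heads read the word `w`, and the other stacks are empty. -/
structure Reads (w : List A) (S : Stacks A H) : Prop where
  zip : ∀ h, (S.pre h).reverse ++ S.suf h = w
  inp : S .inp = []
  out : S .out = []
  ctr : S .ctr = []

/-- The stacks after the heads `i` and `j` have moved one symbol to the right. -/
def Stacks.adv (i j : Fin H) (S : Stacks A H) : Stacks A H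
  | .left h => if h = i ∨ h = j then (S.suf h).head?.toList ++ S.pre h else S.pre h
  | .right h => if h = i ∨ h = j then (S.suf h).tail else S.suf h
  | .inp => S .inp
  | .out => S .out
  | .ctr => S .ctr

/-- The stacks after the heads `i` and `j` have moved one symbol to the left. -/
def Stacks.bk (i j : Fin H) (S : Stacks A H) : Stacks A H
  | .left h => if h = i ∨ h = j then (S.pre h).tail else S.pre h
  | .right h => if h = i ∨ h = j then (S.pre h).head?.toList ++ S.suf h else S.suf h
  | .inp => S .inp
  | .out => S .out
  | .ctr => S .ctr

theorem Stacks.suf_adv (i j h : Fin H) (S : Stacks A H) :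
    (S.adv i j).suf h = if h = i ∨ h = j then (S.suf h).tail else S.suf h := rfl

theorem Stacks.suf_bk (i j h : Fin H) (S : Stacks A H) :
    (S.bk i j).suf h =
      if h = i ∨ h = j then (S.pre h).head?.toList ++ S.suf h else S.suf h := rfl

theorem Stacks.pre_bk (i j h : Fin H) (S : Stacks A H) :
    (S.bk i j).pre h = if h = i ∨ h = j then (S.pre h).tail else S.pre h := rfl

theorem Stacks.pre_adv (i j h : Fin H) (S : Stacks A H) :
    (S.adv i j).pre h =
      if h = i ∨ h = j then (S.suf h).head?.toList ++ S.pre h else S.pre h := rfl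

theorem Stacks.ext_iff {S S' : Stacks A H} : S = S' ↔ (∀ h, S.pre h = S'.pre h) ∧
    (∀ h, S.suf h = S'.suf h) ∧ S .inp = S' .inp ∧ S .out = S' .out ∧ S .ctr = S' .ctr := by
  constructor
  · rintro rfl
    simp
  · rintro ⟨h₁, h₂, h₃, h₄, h₅⟩
    funext k
    cases k with
    | inp => exact h₃
    | out => exact h₄
    | ctr => exact h₅
    | left h => exact h₁ h
    | right h => exact h₂ h

theorem Stacks.bk_adv {i j : Fin H} {S : Stacks A H} (hi : S.suf i ≠ []) (hj : S.suf j ≠ []) :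
    (S.adv i j).bk i j = S := by
  have key : ∀ h, h = i ∨ h = j → ∃ a r, S.suf h = a :: r := by
    rintro h (rfl | rfl) <;> exact List.exists_cons_of_ne_nil ‹_›
  refine Stacks.ext_iff.2 ⟨fun h => ?_, fun h => ?_, rfl, rfl, rfl⟩
  · rw [Stacks.pre_bk, Stacks.pre_adv]
    split_ifs with hh
    · obtain ⟨a, r, e⟩ := key h hh
      simp [e]
    · rfl
  · rw [Stacks.suf_bk, Stacks.pre_adv, Stacks.suf_adv]
    split_ifs with hh
    · obtain ⟨a, r, e⟩ := key h hh
      simp [e]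
    · rfl

theorem Reads.adv {w : List A} {S : Stacks A H} (hS : Reads w S) (i j : Fin H) :
    Reads w (S.adv i j) := by
  refine ⟨fun h => ?_, hS.inp, hS.out, hS.ctr⟩
  have := hS.zip h
  rw [Stacks.pre_adv, Stacks.suf_adv]
  split_ifs
  · cases e : S.suf h with
    | nil => simpa [e] using this
    | cons a r => simpa [e] using this
  · exact this

theorem Reads.bk {w : List A} {S : Stacks A H} (hS : Reads w S) (i j : Fin H) :
    Reads w (S.bk i j) := by
  refine ⟨fun h => ?_, hS.inp, hS.out, hS.ctr⟩
  have := hS.zip h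
  rw [Stacks.pre_bk, Stacks.suf_bk]
  split_ifs
  · cases e : S.pre h with
    | nil => simpa [e] using this
    | cons a r => simpa [e] using this
  · exact this

variable [Inhabited A]

/-- Programs for the machine with heads `Fin H`. -/
abbrev HeadCmd (A : Type) (H : ℕ) : Type := Cmd (Alph A (H := H)) (Reg A)

/-- Instructions for the machine with heads `Fin H`. -/
abbrev HeadPrim (A : Type) (H : ℕ) : Type := Prim (Alph A (H := H)) (Reg A)

/-- Do nothing. -/
def skipC : HeadCmd A H := .prim (.load id)

/-- Move the head `i` one symbol to the right. -/
def stepR (i : Fin H) : HeadCmd A H :=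
  .seq (.prim (.pop (.right i) fun v x => (v.1, x, v.2.2)))
    (.prim (.push (.left i) fun v => v.2.1.getD default))

/-- Move the head `i` one symbol to the left. -/
def stepL (i : Fin H) : HeadCmd A H :=
  .seq (.prim (.pop (.left i) fun v x => (v.1, x, v.2.2)))
    (.prim (.push (.right i) fun v => v.2.1.getD default))

/-- Move the heads `i` and `j` one symbol to the right. If they are the same head, it moves only
once, as in `Stacks.adv`. -/
def advC (i j : Fin H) : HeadCmd A H := .seq (stepR i) (if i = j then skipC else stepR j)

/-- Move the heads `i` and `j` one symbol to the left; if they are the same head, only once. -/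
def bkC (i j : Fin H) : HeadCmd A H := .seq (stepL i) (if i = j then skipC else stepL j)

omit [Inhabited A] in
theorem runs_skipC (s : Mem (Alph A (H := H)) (Reg A)) : Runs skipC s s 1 := Runs.prim (.load id) s

theorem runs_stepR {i : Fin H} {v : Reg A} {S : Stacks A H} (hi : S.suf i ≠ []) :
    ∃ v' : Reg A, v'.1 = v.1 ∧ v'.2.2 = v.2.2 ∧ Runs (stepR i) (v, S) (v', S.adv i i) 2 := by
  obtain ⟨a, r, e⟩ := List.exists_cons_of_ne_nil hi
  refine ⟨(v.1, some a, v.2.2), rfl, rfl, ?_⟩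
  have := Runs.seq (Runs.prim (.pop (.right i) fun v x => (v.1, x, v.2.2)) (v, S))
    (Runs.prim (.push (.left i) fun v : Reg A => v.2.1.getD default) _)
  unfold stepR
  convert this using 1
  have e' : S (.right i) = a :: r := e
  refine Prod.ext ?_ ?_
  · simp [Prim.run, e']
  · refine Stacks.ext_iff.2 ⟨fun h => ?_, fun h => ?_, rfl, rfl, rfl⟩
    · rw [Stacks.pre_adv]
      by_cases hh : h = i
      · subst hh
        simp [Prim.run, e', e, Stacks.pre]
      · simp [Prim.run, hh, Stacks.pre]
    · rw [Stacks.suf_adv]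
      by_cases hh : h = i
      · subst hh
        simp [Prim.run, e', Stacks.suf]
      · simp [Prim.run, hh, Stacks.suf]

theorem runs_stepL {i : Fin H} {v : Reg A} {S : Stacks A H} (hi : S.pre i ≠ []) :
    ∃ v' : Reg A, v'.1 = v.1 ∧ v'.2.2 = v.2.2 ∧ Runs (stepL i) (v, S) (v', S.bk i i) 2 := by
  obtain ⟨a, r, e⟩ := List.exists_cons_of_ne_nil hi
  refine ⟨(v.1, some a, v.2.2), rfl, rfl, ?_⟩
  have := Runs.seq (Runs.prim (.pop (.left i) fun v x => (v.1, x, v.2.2)) (v, S))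
    (Runs.prim (.push (.right i) fun v : Reg A => v.2.1.getD default) _)
  unfold stepL
  convert this using 1
  have e' : S (.left i) = a :: r := e
  refine Prod.ext ?_ ?_
  · simp [Prim.run, e']
  · refine Stacks.ext_iff.2 ⟨fun h => ?_, fun h => ?_, rfl, rfl, rfl⟩
    · rw [Stacks.pre_bk]
      by_cases hh : h = i
      · subst hh
        simp [Prim.run, e', Stacks.pre]
      · simp [Prim.run, hh, Stacks.pre]
    · rw [Stacks.suf_bk]
      by_cases hh : h = i
      · subst hh
        simp [Prim.run, e', e, Stacks.suf]
      · simp [Prim.run, hh, Stacks.suf]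

theorem runs_advC {i j : Fin H} {v : Reg A} {S : Stacks A H} (hi : S.suf i ≠ [])
    (hj : S.suf j ≠ []) :
    ∃ v' : Reg A, v'.1 = v.1 ∧ v'.2.2 = v.2.2 ∧ Runs (advC i j) (v, S) (v', S.adv i j) 4 := by
  obtain ⟨v₁, h₁, h₁', r₁⟩ := runs_stepR (v := v) hi
  by_cases hij : i = j
  · subst hij
    exact ⟨v₁, h₁, h₁', by
      rw [advC, if_pos rfl]
      exact (r₁.seq (runs_skipC _)).mono (by omega)⟩
  · have hj' : (S.adv i i).suf j ≠ [] := by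
      rwa [Stacks.suf_adv, if_neg (by simpa using Ne.symm hij)]
    obtain ⟨v₂, h₂, h₂', r₂⟩ := runs_stepR (v := v₁) hj'
    refine ⟨v₂, h₂.trans h₁, h₂'.trans h₁', ?_⟩
    rw [advC, if_neg hij]
    convert r₁.seq r₂ using 2
    refine Stacks.ext_iff.2 ⟨fun h => ?_, fun h => ?_, rfl, rfl, rfl⟩
    · simp only [Stacks.pre_adv, Stacks.suf_adv, or_self]
      by_cases h1 : h = i
      · subst h1
        simp [hij]
      · simp [h1]
    · simp only [Stacks.suf_adv, or_self]
      by_cases h1 : h = i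
      · subst h1
        simp [hij]
      · simp [h1]

theorem runs_bkC {i j : Fin H} {v : Reg A} {S : Stacks A H} (hi : S.pre i ≠ [])
    (hj : S.pre j ≠ []) :
    ∃ v' : Reg A, v'.1 = v.1 ∧ v'.2.2 = v.2.2 ∧ Runs (bkC i j) (v, S) (v', S.bk i j) 4 := by
  obtain ⟨v₁, h₁, h₁', r₁⟩ := runs_stepL (v := v) hi
  by_cases hij : i = j
  · subst hij
    exact ⟨v₁, h₁, h₁', by
      rw [bkC, if_pos rfl]
      exact (r₁.seq (runs_skipC _)).mono (by omega)⟩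
  · have hj' : (S.bk i i).pre j ≠ [] := by
      rwa [Stacks.pre_bk, if_neg (by simpa using Ne.symm hij)]
    obtain ⟨v₂, h₂, h₂', r₂⟩ := runs_stepL (v := v₁) hj'
    refine ⟨v₂, h₂.trans h₁, h₂'.trans h₁', ?_⟩
    rw [bkC, if_neg hij]
    convert r₁.seq r₂ using 2
    refine Stacks.ext_iff.2 ⟨fun h => ?_, fun h => ?_, rfl, rfl, rfl⟩
    · simp only [Stacks.pre_bk, or_self]
      by_cases h1 : h = i
      · subst h1
        simp [hij]
      · simp [h1]
    · simp only [Stacks.suf_bk, Stacks.pre_bk, or_self]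
      by_cases h1 : h = i
      · subst h1
        simp [hij]
      · simp [h1]

end StackProgram

/-! ### Scanning two suffixes in parallel -/

namespace StackProgram

variable {A : Type} {H : ℕ}

/-- Read two words in parallel until `f` gives a verdict; the verdict is `false` if `f` gives none
before the end of one of the words has been seen. -/
def scan (f : Option A → Option A → Option Bool) : List A → List A → Bool
  | a :: x, b :: y => (f (some a) (some b)).getD (scan f x y)
  | [], y => (f none y.head?).getD false
  | a :: _, [] => (f (some a) none).getD false

variable [Inhabited A]

/-- Push a mark on the counter. -/
def tick : HeadCmd A H := .prim (.push .ctr fun _ => default)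

/-- Read the symbols at the heads `i` and `j` into the registers. -/
def look (i j : Fin H) : HeadCmd A H :=
  .seq (.prim (.peek (.right i) fun v x => (v.1, x, v.2.2)))
    (.prim (.peek (.right j) fun v x => (v.1, v.2.1, x)))

/-- The condition for continuing a parallel scan. -/
def scanning (f : Option A → Option A → Option Bool) (v : Reg A) : Bool :=
  (f v.2.1 v.2.2).isNone && v.2.1.isSome && v.2.2.isSome

/-- Move the heads `i` and `j` to the right, counting the moves, until `f` gives a verdict. -/
def scanLoop (f : Option A → Option A → Option Bool) (i j : Fin H) : HeadCmd A H :=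
  .loop (scanning f) (.seq (.seq tick (advC i j)) (look i j))

/-- Read the top of the counter into the second register. -/
def lookCtr : HeadCmd A H := .prim (.peek .ctr fun v x => (v.1, v.2.1, x))

/-- Remove a mark from the counter. -/
def untick : HeadCmd A H := .prim (.pop .ctr fun v _ => v)

/-- Move the heads `i` and `j` back to the left as often as the counter says. -/
def backLoop (i j : Fin H) : HeadCmd A H :=
  .loop (fun v => v.2.2.isSome) (.seq (.seq (bkC i j) untick) lookCtr)

/-- Set the flag to the result of the parallel scan of the suffixes at the heads `i` and `j`. -/
def scanC (f : Option A → Option A → Option Bool) (i j : Fin H) : HeadCmd A H :=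
  .seq (.seq (look i j) (scanLoop f i j))
    (.seq (.seq (.prim (.load fun v => ((f v.2.1 v.2.2).getD false, v.2))) lookCtr) (backLoop i j))

omit [Inhabited A] in
theorem runs_look (i j : Fin H) (v : Reg A) (S : Stacks A H) :
    Runs (look i j) (v, S) ((v.1, (S.suf i).head?, (S.suf j).head?), S) 2 :=
  (Runs.prim (.peek (.right i) fun v x => (v.1, x, v.2.2) : HeadPrim A H) (v, S)).seq
    (Runs.prim (.peek (.right j) fun v x => (v.1, v.2.1, x) : HeadPrim A H) _)

/-- The stacks with contents `c` of the counter. -/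
def Stacks.setCtr (S : Stacks A H) (c : List A) : Stacks A H := Function.update S .ctr c

omit [Inhabited A] in
theorem Stacks.setCtr_ctr (S : Stacks A H) (c : List A) : S.setCtr c .ctr = c := by
  simp [Stacks.setCtr]

omit [Inhabited A] in
theorem Stacks.suf_setCtr (S : Stacks A H) (c : List A) (h : Fin H) :
    (S.setCtr c).suf h = S.suf h := rfl

omit [Inhabited A] in
theorem Stacks.pre_setCtr (S : Stacks A H) (c : List A) (h : Fin H) :
    (S.setCtr c).pre h = S.pre h := rfl

omit [Inhabited A] in
theorem Stacks.setCtr_setCtr (S : Stacks A H) (c c' : List A) :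
    (S.setCtr c).setCtr c' = S.setCtr c' := by
  simp [Stacks.setCtr]

omit [Inhabited A] in
theorem Stacks.setCtr_self {S : Stacks A H} {c : List A} (h : S .ctr = c) : S.setCtr c = S := by
  simp [Stacks.setCtr, ← h]

omit [Inhabited A] in
theorem Stacks.adv_setCtr (i j : Fin H) (S : Stacks A H) (c : List A) :
    (S.setCtr c).adv i j = (S.adv i j).setCtr c := by
  refine Stacks.ext_iff.2 ⟨fun h => rfl, fun h => rfl, rfl, rfl, ?_⟩
  rw [Stacks.setCtr_ctr]
  exact S.setCtr_ctr c

omit [Inhabited A] in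
theorem Stacks.bk_setCtr (i j : Fin H) (S : Stacks A H) (c : List A) :
    (S.setCtr c).bk i j = (S.bk i j).setCtr c := by
  refine Stacks.ext_iff.2 ⟨fun h => rfl, fun h => rfl, rfl, rfl, ?_⟩
  rw [Stacks.setCtr_ctr]
  exact S.setCtr_ctr c

/-- `Advanced i j n S S'`: the stacks `S'` arise from `S` by moving the heads `i` and `j` to the
right `n` times, with each move counted. -/
inductive Advanced (i j : Fin H) : ℕ → Stacks A H → Stacks A H → Prop
  | refl (S : Stacks A H) : Advanced i j 0 S S
  | step {n : ℕ} {S S' : Stacks A H} : Advanced i j n S S' → S'.suf i ≠ [] → S'.suf j ≠ [] →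
      Advanced i j (n + 1) S ((S'.adv i j).setCtr (default :: S' .ctr))

theorem Advanced.head {i j : Fin H} {n : ℕ} {S S₁ S' : Stacks A H} (hi : S.suf i ≠ [])
    (hj : S.suf j ≠ []) (hS : S₁ = (S.adv i j).setCtr (default :: S .ctr))
    (h : Advanced i j n S₁ S') : Advanced i j (n + 1) S S' := by
  induction h with
  | refl S =>
    subst hS
    exact .step (.refl _) hi hj
  | step _ h₁ h₂ ih => exact .step (ih hS) h₁ h₂

theorem runs_tick (v : Reg A) (S : Stacks A H) :
    Runs tick (v, S) (v, S.setCtr (default :: S .ctr)) 1 :=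
  Runs.prim (.push .ctr fun _ => default : HeadPrim A H) (v, S)

/-- The scanning loop stops with the symbols in the registers that decide the scan, after moves
that are recorded on the counter. -/
theorem runs_scanLoop (f : Option A → Option A → Option Bool) (i j : Fin H) (x : List A) :
    ∀ (v : Reg A) (S : Stacks A H), S.suf i = x → v.2.1 = x.head? → v.2.2 = (S.suf j).head? →
      ∃ n, ∃ (v' : Reg A) (S' : Stacks A H), n ≤ x.length ∧ Advanced i j n S S' ∧
        Runs (scanLoop f i j) (v, S) (v', S') (8 * x.length + 1) ∧
        (f v'.2.1 v'.2.2).getD false = scan f x (S.suf j) := by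
  induction x with
  | nil =>
    intro v S hx ha hb
    refine ⟨0, v, S, le_rfl, .refl _, .mono (.loop_false ?_) (by omega), ?_⟩
    · simp [scanning, ha]
    · rw [ha, hb, scan]
      rfl
  | cons a x ih =>
    intro v S hx ha hb
    cases hy : S.suf j with
    | nil =>
      refine ⟨0, v, S, by omega, .refl _, .mono (.loop_false ?_) (by omega), ?_⟩
      · simp [scanning, hb, hy]
      · rw [ha, hb, hy, scan]
        rfl
    | cons b y =>
      rw [hy] at hb
      have hi : S.suf i ≠ [] := by simp [hx]
      have hj : S.suf j ≠ [] := by simp [hy]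
      cases hf : f (some a) (some b) with
      | some r =>
        refine ⟨0, v, S, by omega, .refl _, .mono (.loop_false ?_) (by omega), ?_⟩
        · simp [scanning, hb, ha, hf]
        · simp [ha, hb, scan, hf]
      | none =>
        obtain ⟨v₁, -, -, r₁⟩ := runs_advC (v := v) (S := S.setCtr (default :: S .ctr)) hi hj
        rw [Stacks.adv_setCtr] at r₁
        set S₁ := (S.adv i j).setCtr (default :: S .ctr) with hS₁
        have hi₁ : S₁.suf i = x := by
          rw [hS₁, Stacks.suf_setCtr, Stacks.suf_adv, if_pos (Or.inl rfl), hx]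
          rfl
        have hj₁ : S₁.suf j = y := by
          rw [hS₁, Stacks.suf_setCtr, Stacks.suf_adv, if_pos (Or.inr rfl), hy]
          rfl
        obtain ⟨n, v', S', hn, hadv, hr, hres⟩ :=
          ih (v₁.1, (S₁.suf i).head?, (S₁.suf j).head?) S₁ hi₁ (by rw [hi₁]) rfl
        refine ⟨n + 1, v', S', by simpa using hn, hadv.head hi hj hS₁,
          .mono (.loop_true (by simp [scanning, ha, hb, hf])
            (((runs_tick v S).seq r₁).seq (runs_look i j v₁ S₁)) hr)
            (by simp only [List.length_cons]; omega), ?_⟩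
        rw [hres, hj₁]
        simp [scan, hf]

omit [Inhabited A] in
theorem runs_lookCtr (v : Reg A) (S : Stacks A H) :
    Runs lookCtr (v, S) ((v.1, v.2.1, (S .ctr).head?), S) 1 :=
  Runs.prim (.peek .ctr fun v x => (v.1, v.2.1, x) : HeadPrim A H) (v, S)

omit [Inhabited A] in
theorem runs_untick (v : Reg A) (S : Stacks A H) :
    Runs untick (v, S) (v, S.setCtr (S .ctr).tail) 1 :=
  Runs.prim (.pop .ctr fun v _ => v : HeadPrim A H) (v, S)

/-- The moves recorded on the counter can be undone. -/
theorem runs_backLoop {i j : Fin H} {n : ℕ} {S S' : Stacks A H} (h : Advanced i j n S S')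
    (hS : S .ctr = []) : ∀ v : Reg A, v.2.2 = (S' .ctr).head? → ∃ v' : Reg A, v'.1 = v.1 ∧
      Runs (backLoop i j) (v, S') (v', S) (7 * n + 1) := by
  induction h with
  | refl S =>
    intro v hv
    exact ⟨v, rfl, .loop_false (by simp [hv, hS])⟩
  | @step n S S' _ hi hj ih =>
    intro v hv
    set S₁ := (S'.adv i j).setCtr (default :: S' .ctr) with hS₁
    have hbk : S₁.bk i j = S'.setCtr (default :: S' .ctr) := by
      rw [hS₁, Stacks.bk_setCtr, Stacks.bk_adv hi hj]
    have hp : ∀ h, h = i ∨ h = j → S₁.pre h ≠ [] := by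
      intro h hh
      have hne : S'.suf h ≠ [] := by rcases hh with rfl | rfl <;> assumption
      obtain ⟨a, r, e⟩ := List.exists_cons_of_ne_nil hne
      rw [hS₁, Stacks.pre_setCtr, Stacks.pre_adv, if_pos hh, e]
      simp
    obtain ⟨v₁, h₁, h₁', r₁⟩ := runs_bkC (v := v) (hp i (.inl rfl)) (hp j (.inr rfl))
    have r₂ := runs_untick v₁ (S₁.bk i j)
    have e₂ : (S₁.bk i j).setCtr ((S₁.bk i j) .ctr).tail = S' := by
      rw [hbk, Stacks.setCtr_ctr, Stacks.setCtr_setCtr, List.tail_cons]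
      exact Stacks.setCtr_self rfl
    rw [e₂] at r₂
    obtain ⟨v', h', r'⟩ := ih hS (v₁.1, v₁.2.1, (S' .ctr).head?) rfl
    exact ⟨v', h'.trans h₁, .mono (.loop_true
      (by rw [hv, hS₁, Stacks.setCtr_ctr]; rfl)
      ((r₁.seq r₂).seq (runs_lookCtr v₁ S')) r') (by omega)⟩

/-- A scan leaves all stacks unchanged. -/
theorem runs_scanC (f : Option A → Option A → Option Bool) (i j : Fin H) {v : Reg A}
    {S : Stacks A H} (hS : S .ctr = []) :
    ∃ v' : Reg A, v'.1 = scan f (S.suf i) (S.suf j) ∧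
      Runs (scanC f i j) (v, S) (v', S) (15 * (S.suf i).length + 6) := by
  obtain ⟨n, v₁, S₁, hn, hadv, hr, hres⟩ := runs_scanLoop f i j (S.suf i)
    (v.1, (S.suf i).head?, (S.suf j).head?) S rfl rfl rfl
  obtain ⟨v₂, h₂, r₂⟩ := runs_backLoop hadv hS
    ((f v₁.2.1 v₁.2.2).getD false, v₁.2.1, (S₁ .ctr).head?) rfl
  have r₃ : Runs (.prim (.load fun v : Reg A => ((f v.2.1 v.2.2).getD false, v.2)))
      (v₁, S₁) (((f v₁.2.1 v₁.2.2).getD false, v₁.2), S₁) 1 :=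
    Runs.prim (.load fun v : Reg A => ((f v.2.1 v.2.2).getD false, v.2)) (v₁, S₁)
  exact ⟨v₂, h₂.trans hres, .mono (((runs_look i j v S).seq hr).seq
    ((r₃.seq (runs_lookCtr _ S₁)).seq r₂)) (by omega)⟩

end StackProgram

/-! ### Formulas about the suffixes of a word -/

namespace StackProgram

/-- First-order formulas with de Bruijn indices; the variables range over the suffixes of a word
(that is, over its positions). The atoms compare two suffixes by a parallel scan. -/
inductive Fm (A : Type) where
  | scan (f : Option A → Option A → Option Bool) (i j : ℕ) : Fm A
  | not (φ : Fm A) : Fm A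
  | and (φ ψ : Fm A) : Fm A
  | ex (φ : Fm A) : Fm A

variable {A : Type}

/-- Add a value for the variable with index `0` to a valuation. -/
def vcons (s : List A) (ν : ℕ → List A) : ℕ → List A
  | 0 => s
  | i + 1 => ν i

/-- Truth of a formula in the word `w` under the valuation `ν`. -/
def Fm.Holds (w : List A) : Fm A → (ℕ → List A) → Prop
  | .scan f i j, ν => StackProgram.scan f (ν i) (ν j) = true
  | .not φ, ν => ¬ φ.Holds w ν
  | .and φ ψ, ν => φ.Holds w ν ∧ ψ.Holds w ν
  | .ex φ, ν => ∃ s, s <:+ w ∧ φ.Holds w (vcons s ν)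

/-- The quantifier depth. -/
def Fm.depth : Fm A → ℕ
  | .scan _ _ _ => 0
  | .not φ => φ.depth
  | .and φ ψ => max φ.depth ψ.depth
  | .ex φ => φ.depth + 1

/-- The head with a given number. -/
def hd (D i : ℕ) : Fin (D + 1) := Fin.ofNat (D + 1) i

theorem hd_val {D i : ℕ} (h : i ≤ D) : (hd D i : ℕ) = i := by
  simp [hd, Nat.mod_eq_of_lt (Nat.lt_succ_of_le h)]

/-- The valuation of the variables when `d` heads are in use: the variable bound last is stored at
the head `d - 1`. Indices without a binder refer to the head `0`. -/
def val (D d : ℕ) (S : Stacks A (D + 1)) (i : ℕ) : List A := S.suf (hd D (d - 1 - i))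

theorem val_succ (D d : ℕ) (S : Stacks A (D + 1)) :
    val D (d + 1) S = vcons (S.suf (hd D d)) (val D d S) := by
  funext i
  cases i with
  | zero => simp [val, vcons]
  | succ i =>
    simp only [val, vcons]
    congr 2
    omega

variable [Inhabited A]

/-- Read the symbol to the left of the head `h`. -/
def lookL (h : Fin (D + 1)) : HeadCmd A (D + 1) :=
  .prim (.peek (.left h) fun v x => (v.1, x, v.2.2))

/-- Move the head `h` to the beginning of the word. -/
def rewind (h : Fin (D + 1)) : HeadCmd A (D + 1) :=
  .seq (lookL h) (.loop (fun v => v.2.1.isSome) (.seq (stepL h) (lookL h)))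

/-- Move the head `h` to the right, executing `c` at each position, until `c` sets the flag or the
end of the word has been reached. -/
def search (h : Fin (D + 1)) (c : HeadCmd A (D + 1)) : HeadCmd A (D + 1) :=
  .loop (fun v => !v.1 && v.2.1.isSome) (.seq (stepR h) (.seq c (look h h)))

/-- The program that evaluates a formula when the heads below `d` store its variables. A quantifier
stores its variable at the head `d`, which is free. -/
def prog (D : ℕ) : ℕ → Fm A → HeadCmd A (D + 1)
  | d, .scan f i j => scanC f (hd D (d - 1 - i)) (hd D (d - 1 - j))
  | d, .not φ => .seq (prog D d φ) (.prim (.load fun v => (!v.1, v.2)))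
  | d, .and φ ψ => .seq (prog D d φ) (.when (fun v => v.1) (prog D d ψ))
  | d, .ex φ => .seq (rewind (hd D d))
      (.seq (.seq (prog D (d + 1) φ) (look (hd D d) (hd D d)))
        (search (hd D d) (prog D (d + 1) φ)))

/-- The program `c`, which may move only the heads from `d` on, sets the flag to the truth value
of `P` for the suffixes stored at the heads below `d`, in time `T`. -/
def Evaluates (D d : ℕ) (c : HeadCmd A (D + 1)) (P : List A → (ℕ → List A) → Prop)
    (T : ℕ → ℕ) : Prop :=
  ∀ (w : List A) (v : Reg A) (S : Stacks A (D + 1)), Reads w S →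
    ∃ (v' : Reg A) (S' : Stacks A (D + 1)), Runs c (v, S) (v', S') (T w.length) ∧ Reads w S' ∧
      (∀ h : Fin (D + 1), h.val < d → S'.suf h = S.suf h) ∧ (v'.1 = true ↔ P w (val D d S))

omit [Inhabited A] in
theorem Reads.suf_suffix {H : ℕ} {w : List A} {S : Stacks A H} (hS : Reads w S) (h : Fin H) :
    S.suf h <:+ w := ⟨_, hS.zip h⟩

omit [Inhabited A] in
theorem val_congr {D d : ℕ} {S S' : Stacks A (D + 1)} (hd0 : 0 < d) (hdD : d ≤ D + 1)
    (h : ∀ h : Fin (D + 1), h.val < d → S'.suf h = S.suf h) : val D d S' = val D d S := by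
  funext i
  refine h _ ?_
  rw [hd_val (by omega)]
  omega

omit [Inhabited A] in
theorem runs_lookL {D : ℕ} (h : Fin (D + 1)) (v : Reg A) (S : Stacks A (D + 1)) :
    Runs (lookL h) (v, S) ((v.1, (S.pre h).head?, v.2.2), S) 1 :=
  Runs.prim (.peek (.left h) fun v x => (v.1, x, v.2.2) : HeadPrim A (D + 1)) (v, S)

theorem runs_rewind {D : ℕ} {w : List A} (h : Fin (D + 1)) (v : Reg A) (S : Stacks A (D + 1))
    (hS : Reads w S) : ∃ (v' : Reg A) (S' : Stacks A (D + 1)),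
      Runs (rewind h) (v, S) (v', S') (4 * w.length + 2) ∧ Reads w S' ∧ S'.suf h = w ∧
        ∀ h', h' ≠ h → S'.suf h' = S.suf h' := by
  have key : ∀ (l : List A) (v : Reg A) (S : Stacks A (D + 1)), Reads w S → S.pre h = l →
      v.2.1 = l.head? → ∃ (v' : Reg A) (S' : Stacks A (D + 1)),
        Runs (.loop (fun v => v.2.1.isSome) (.seq (stepL h) (lookL h))) (v, S) (v', S')
          (4 * l.length + 1) ∧ Reads w S' ∧ S'.suf h = w ∧
        ∀ h', h' ≠ h → S'.suf h' = S.suf h' := by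
    intro l
    induction l with
    | nil =>
      intro v S hS hl hv
      refine ⟨v, S, .mono (.loop_false (by simp [hv])) (by omega), hS, ?_, fun _ _ => rfl⟩
      simpa [hl] using hS.zip h
    | cons a l ih =>
      intro v S hS hl hv
      obtain ⟨v₁, -, -, r₁⟩ := runs_stepL (v := v) (S := S) (i := h) (by simp [hl])
      have hl' : (S.bk h h).pre h = l := by
        rw [Stacks.pre_bk, if_pos (Or.inl rfl), hl]
        rfl
      obtain ⟨v', S', r', hS', e', hh'⟩ := ih (v₁.1, ((S.bk h h).pre h).head?, v₁.2.2) _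
        (hS.bk h h) hl' (by rw [hl'])
      refine ⟨v', S', .mono (.loop_true (by simp [hv]) (r₁.seq (runs_lookL h v₁ _)) r')
        (by simp only [List.length_cons]; omega), hS', e', fun h' hne => ?_⟩
      rw [hh' h' hne, Stacks.suf_bk, if_neg (by simpa using hne)]
  obtain ⟨v', S', r, h'⟩ := key (S.pre h) (v.1, (S.pre h).head?, v.2.2) S hS rfl rfl
  have hlen : (S.pre h).length ≤ w.length := by
    rw [← hS.zip h]
    simp
  exact ⟨v', S', .mono ((runs_lookL h v S).seq r) (by omega), h'⟩

/-- Searching from the suffix `s` on: if the flag tells whether `P` holds at `s`, the search sets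
it according to whether `P` holds at some suffix of `s`. -/
theorem runs_search {D d : ℕ} {c : HeadCmd A (D + 1)} {P : List A → (ℕ → List A) → Prop}
    {T : ℕ → ℕ} (hd0 : 0 < d) (hdD : d ≤ D) (hc : Evaluates D (d + 1) c P T) {w : List A}
    {ν : ℕ → List A} (s : List A) : ∀ (v : Reg A) (S : Stacks A (D + 1)), Reads w S →
      S.suf (hd D d) = s → v.2.1 = s.head? → val D d S = ν → (v.1 = true ↔ P w (vcons s ν)) →
      ∃ (v' : Reg A) (S' : Stacks A (D + 1)),
        Runs (search (hd D d) c) (v, S) (v', S') (s.length * (T w.length + 5) + 1) ∧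
        Reads w S' ∧ (∀ h : Fin (D + 1), h.val < d → S'.suf h = S.suf h) ∧
        (v'.1 = true ↔ ∃ s', s' <:+ s ∧ P w (vcons s' ν)) := by
  induction s with
  | nil =>
    intro v S hS hs hv hν hP
    refine ⟨v, S, .mono (.loop_false (by simp [hv])) (by omega), hS, fun _ _ => rfl, ?_⟩
    simpa using hP
  | cons a s ih =>
    intro v S hS hs hv hν hP
    cases hf : v.1 with
    | true =>
      refine ⟨v, S, .mono (.loop_false (by simp [hf])) (by omega), hS, fun _ _ => rfl, ?_⟩
      simp only [hf, true_iff]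
      exact ⟨_, List.suffix_rfl, hP.1 hf⟩
    | false =>
      obtain ⟨v₁, h₁, -, r₁⟩ := runs_stepR (v := v) (S := S) (i := hd D d) (by simp [hs])
      set S₁ := S.adv (hd D d) (hd D d) with hS₁
      have hs₁ : S₁.suf (hd D d) = s := by
        rw [hS₁, Stacks.suf_adv, if_pos (Or.inl rfl), hs]
        rfl
      have hlow : ∀ h : Fin (D + 1), h.val < d → S₁.suf h = S.suf h := by
        intro h hh
        have hne : h ≠ hd D d := by
          rintro rfl
          rw [hd_val hdD] at hh
          omega
        rw [hS₁, Stacks.suf_adv, if_neg (by simpa using hne)]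
      obtain ⟨v₂, S₂, r₂, hS₂, hlow₂, hv₂⟩ := hc w v₁ S₁ (hS.adv _ _)
      have hs₂ : S₂.suf (hd D d) = s := by
        rw [hlow₂ _ (by rw [hd_val hdD]; omega), hs₁]
      have hlow₃ : ∀ h : Fin (D + 1), h.val < d → S₂.suf h = S.suf h := fun h hh =>
        (hlow₂ h (by omega)).trans (hlow h hh)
      obtain ⟨v', S', r', hS', hlow', hv'⟩ := ih
        (v₂.1, (S₂.suf (hd D d)).head?, (S₂.suf (hd D d)).head?) S₂ hS₂ hs₂
        (by rw [hs₂]) (by rw [val_congr hd0 (by omega) hlow₃, hν])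
        (by rw [hv₂, val_succ, hs₁, val_congr hd0 (by omega) hlow, hν])
      refine ⟨v', S', .mono (.loop_true (by simp [hf, hv])
        (r₁.seq (r₂.seq (runs_look _ _ v₂ S₂))) r') ?_, hS',
        fun h hh => (hlow' h hh).trans (hlow₃ h hh), ?_⟩
      · simp only [List.length_cons, Nat.succ_mul]
        omega
      · rw [hv']
        constructor
        · rintro ⟨s', hs', h'⟩
          exact ⟨s', hs'.trans (List.suffix_cons a s), h'⟩
        · rintro ⟨s', hs', h'⟩
          rcases List.suffix_cons_iff.1 hs' with rfl | hs'
          · simp [hP.2 h'] at hf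
          · exact ⟨s', hs', h'⟩

/-- A bound for the number of steps in the evaluation of a formula, as a polynomial in the length of
the word. -/
noncomputable def Fm.time : Fm A → Polynomial ℕ
  | .scan _ _ _ => 15 * .X + 6
  | .not φ => φ.time + 1
  | .and φ ψ => φ.time + (ψ.time + 1)
  | .ex φ => (4 * .X + 2) + ((φ.time + 2) + (.X * (φ.time + 5) + 1))

/-- Formulas are evaluated correctly and in polynomial time if there are enough heads. With `0 < d`,
the head `0`, to which variables without a binder refer, is not reused. -/
theorem evaluates_prog (D : ℕ) (φ : Fm A) : ∀ d, 0 < d → d + φ.depth ≤ D + 1 →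
    Evaluates D d (prog D d φ) (fun w => φ.Holds w) (fun L => φ.time.eval L) := by
  induction φ with
  | scan f i j =>
    intro d hd0 hdD w v S hS
    obtain ⟨v', h', r⟩ := runs_scanC f (hd D (d - 1 - i)) (hd D (d - 1 - j)) (v := v) hS.ctr
    refine ⟨v', S, r.mono ?_, hS, fun _ _ => rfl, ?_⟩
    · have := (hS.suf_suffix (hd D (d - 1 - i))).length_le
      simp only [Fm.time, Polynomial.eval_add, Polynomial.eval_mul, Polynomial.eval_X,
        Polynomial.eval_ofNat]
      omega
    · rw [h']
      rfl
  | not φ ih =>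
    intro d hd0 hdD w v S hS
    obtain ⟨v', S', r, hS', hlow, hv⟩ := ih d hd0 hdD w v S hS
    refine ⟨(!v'.1, v'.2), S', .mono (r.seq (Runs.prim
      (.load fun v => (!v.1, v.2) : HeadPrim A (D + 1)) (v', S'))) ?_, hS', hlow, ?_⟩
    · simp [Fm.time]
    · simp [Fm.Holds, ← hv]
  | and φ ψ ih ih' =>
    intro d hd0 hdD w v S hS
    simp only [Fm.depth] at hdD
    obtain ⟨v₁, S₁, r₁, hS₁, hlow₁, hv₁⟩ := ih d hd0 (by omega) w v S hS
    cases hf : v₁.1 with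
    | false =>
      refine ⟨v₁, S₁, .mono (r₁.seq (.when_false hf)) ?_, hS₁, hlow₁, ?_⟩
      · simp only [Fm.time, Polynomial.eval_add, Polynomial.eval_one]
        omega
      · simp only [Fm.Holds, ← hv₁, hf, Bool.false_eq_true, false_and]
    | true =>
      obtain ⟨v₂, S₂, r₂, hS₂, hlow₂, hv₂⟩ := ih' d hd0 (by omega) w v₁ S₁ hS₁
      refine ⟨v₂, S₂, .mono (r₁.seq (.when_true hf r₂)) ?_, hS₂,
        fun h hh => (hlow₂ h hh).trans (hlow₁ h hh), ?_⟩
      · simp [Fm.time]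
      · rw [hv₂, val_congr hd0 (by omega) hlow₁]
        simp [Fm.Holds, ← hv₁, hf]
  | ex φ ih =>
    intro d hd0 hdD w v S hS
    simp only [Fm.depth] at hdD
    obtain ⟨v₁, S₁, r₁, hS₁, hw₁, hne₁⟩ := runs_rewind (hd D d) v S hS
    have hc := ih (d + 1) (by omega) (by omega)
    obtain ⟨v₂, S₂, r₂, hS₂, hlow₂, hv₂⟩ := hc w v₁ S₁ hS₁
    have hw₂ : S₂.suf (hd D d) = w := by
      rw [hlow₂ _ (by rw [hd_val (by omega)]; omega), hw₁]
    have hlow₁ : ∀ h : Fin (D + 1), h.val < d → S₁.suf h = S.suf h := by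
      intro h hh
      refine hne₁ h ?_
      rintro rfl
      rw [hd_val (by omega)] at hh
      omega
    have hlow₃ : ∀ h : Fin (D + 1), h.val < d → S₂.suf h = S.suf h := fun h hh =>
      (hlow₂ h (by omega)).trans (hlow₁ h hh)
    obtain ⟨v', S', r', hS', hlow', hv'⟩ := runs_search hd0 (by omega) hc w
      (v₂.1, (S₂.suf (hd D d)).head?, (S₂.suf (hd D d)).head?) S₂ hS₂ hw₂ (by rw [hw₂]) rfl
      (by rw [hv₂, val_succ, hw₁, val_congr hd0 (by omega) hlow₃,
        val_congr hd0 (by omega) hlow₁])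
    refine ⟨v', S', .mono (r₁.seq ((r₂.seq (runs_look _ _ v₂ S₂)).seq r')) ?_, hS',
      fun h hh => (hlow' h hh).trans (hlow₃ h hh), ?_⟩
    · simp [Fm.time]
    · rw [hv', val_congr hd0 (by omega) hlow₃]
      rfl

/-! ### The machine that decides a formula -/

/-- Execute a list of programs one after the other. -/
def seqs {H : ℕ} : List (HeadCmd A H) → HeadCmd A H
  | [] => skipC
  | c :: l => .seq c (seqs l)

/-- Read and remove the next symbol of the input. -/
def readInp {H : ℕ} : HeadCmd A H := .prim (.pop .inp fun v x => (v.1, x, v.2.2))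

/-- Copy the input word to all heads. -/
def copyInput (H : ℕ) : HeadCmd A H :=
  .seq readInp (.loop (fun v => v.2.1.isSome)
    (.seq (seqs ((List.finRange H).map fun h =>
      .prim (.push (.left h) fun v => v.2.1.getD default))) readInp))

/-- The stacks when the heads have read `x` and `y` remains on the input stack. -/
def copying {H : ℕ} (x y : List A) : Stacks A H
  | .inp => y
  | .out => []
  | .ctr => []
  | .left _ => x.reverse
  | .right _ => []

theorem runs_pushes {H : ℕ} (a : A) (v : Reg A) (hv : v.2.1 = some a) (l : List (Fin H))
    (hl : l.Nodup) : ∀ S : Stacks A H, ∃ S' : Stacks A H,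
    Runs (seqs (l.map fun h => .prim (.push (.left h) fun v => v.2.1.getD default))) (v, S) (v, S')
      (l.length + 1) ∧ (∀ h, S'.pre h = if h ∈ l then a :: S.pre h else S.pre h) ∧
      (∀ h, S'.suf h = S.suf h) ∧ S' .inp = S .inp ∧ S' .out = S .out ∧ S' .ctr = S .ctr := by
  induction l with
  | nil => exact fun S => ⟨S, runs_skipC _, by simp⟩
  | cons i l ih =>
    intro S
    obtain ⟨hi, hl⟩ := List.nodup_cons.1 hl
    have r₁ := Runs.prim (.push (.left i) fun v => v.2.1.getD default : HeadPrim A H) (v, S)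
    obtain ⟨S', r', h₁, h₂, h₃⟩ := ih hl
      ((.push (.left i) fun v => v.2.1.getD default : HeadPrim A H).run (v, S)).2
    refine ⟨S', .mono (r₁.seq r') (by simp only [List.length_cons]; omega), fun h => ?_, h₂, h₃⟩
    rw [h₁]
    by_cases hh : h = i
    · subst hh
      simp [hi, Prim.run, hv, Stacks.pre]
    · simp [hh, Prim.run, Stacks.pre]

theorem runs_copyInput (H : ℕ) (w : List A) (v : Reg A) : ∃ v' : Reg A,
    Runs (copyInput H) (v, copying [] w) (v', copying w []) (w.length * (H + 4) + 4) := by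
  have hread : ∀ (v : Reg A) (x y : List A), Runs (readInp : HeadCmd A H) (v, copying x y)
      ((v.1, y.head?, v.2.2), copying x y.tail) 1 := by
    intro v x y
    unfold readInp
    convert Runs.prim (.pop .inp fun v x => (v.1, x, v.2.2) : HeadPrim A H) (v, copying x y)
      using 1
    refine Prod.ext rfl (Stacks.ext_iff.2 ⟨fun _ => rfl, fun _ => rfl, ?_, rfl, rfl⟩)
    simp [Prim.run, copying]
  have key : ∀ (y x : List A) (v : Reg A), v.2.1 = y.head? → ∃ v' : Reg A,
      Runs (.loop (fun v => v.2.1.isSome)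
        (.seq (seqs ((List.finRange H).map fun h =>
          .prim (.push (.left h) fun v => v.2.1.getD default))) readInp)) (v, copying x y.tail)
        (v', copying (x ++ y) []) (y.length * (H + 4) + 1) := by
    intro y
    induction y with
    | nil =>
      intro x v hv
      exact ⟨v, by simpa using .mono (.loop_false (by simp [hv])) (by omega)⟩
    | cons a y ih =>
      intro x v hv
      obtain ⟨S', r, h₁, h₂, h₃, h₄, h₅⟩ := runs_pushes a v hv (List.finRange H)
        (List.nodup_finRange H) (copying x y)
      have hS' : S' = copying (x ++ [a]) y := by
        refine Stacks.ext_iff.2 ⟨fun h => ?_, h₂, h₃, h₄, h₅⟩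
        rw [h₁, if_pos (List.mem_finRange h)]
        simp [Stacks.pre, copying]
      subst hS'
      obtain ⟨v', r'⟩ := ih (x ++ [a]) (v.1, y.head?, v.2.2) rfl
      refine ⟨v', ?_⟩
      rw [List.append_assoc] at r'
      refine .mono (.loop_true (by simp [hv]) (r.seq (hread v _ _)) r') ?_
      simp only [List.length_cons, List.length_finRange, Nat.succ_mul]
      omega
  obtain ⟨v', r'⟩ := key w [] (v.1, w.head?, v.2.2) rfl
  exact ⟨v', .mono ((hread v [] w).seq r') (by omega)⟩

/-- Remove the top of the stack `k` and remember in the second register whether there was one. -/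
def drop1 {H : ℕ} (k : Stk H) : HeadCmd A H :=
  .prim (.pop k fun v x => (v.1, v.2.1, x.map fun _ => default))

/-- Empty the stack `k`. -/
def clear {H : ℕ} (k : Stk H) : HeadCmd A H :=
  .seq (drop1 k) (.loop (fun v => v.2.2.isSome) (drop1 k))

theorem runs_clear {H : ℕ} (k : Stk H) (v : Reg A) (S : Stacks A H) : ∃ v' : Reg A,
    v'.1 = v.1 ∧ Runs (clear k) (v, S) (v', Function.update S k []) (2 * (S k).length + 2) := by
  have hdrop : ∀ (v : Reg A) (S : Stacks A H), Runs (drop1 k) (v, S)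
      ((v.1, v.2.1, (S k).head?.map fun _ => default), Function.update S k (S k).tail) 1 :=
    fun v S => Runs.prim (.pop k fun v x => (v.1, v.2.1, x.map fun _ => default) : HeadPrim A H)
      (v, S)
  have key : ∀ (y : List (Alph A k)) (v : Reg A) (S : Stacks A H),
      v.2.2.isSome = y.head?.isSome → S k = y.tail → ∃ v' : Reg A, v'.1 = v.1 ∧
        Runs (.loop (fun v => v.2.2.isSome) (drop1 k)) (v, S) (v', Function.update S k [])
          (2 * y.length + 1) := by
    intro y
    induction y with
    | nil =>
      intro v S hv hS
      refine ⟨v, rfl, ?_⟩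
      rw [Function.update_eq_self_iff.2 hS.symm]
      exact .mono (.loop_false (by simp [hv])) (by omega)
    | cons a y ih =>
      intro v S hv hS
      obtain ⟨v', h', r'⟩ := ih (v.1, v.2.1, (S k).head?.map fun _ => default)
        (Function.update S k (S k).tail) (by simp [hS]) (by simp [hS])
      rw [Function.update_idem] at r'
      exact ⟨v', h', .mono (.loop_true (by simp [hv]) (hdrop v S) r')
        (by simp only [List.length_cons]; omega)⟩
  obtain ⟨v', h', r'⟩ := key (S k) (v.1, v.2.1, (S k).head?.map fun _ => default)
    (Function.update S k (S k).tail) (by simp) (by simp)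
  rw [Function.update_idem] at r'
  exact ⟨v', h', .mono ((hdrop v S).seq r') (by omega)⟩

theorem runs_clears {H : ℕ} (L : ℕ) (l : List (Stk H)) : ∀ (v : Reg A) (S : Stacks A H),
    (∀ k, (S k).length ≤ L) → ∃ v' : Reg A, v'.1 = v.1 ∧
      Runs (seqs (l.map clear)) (v, S) (v', fun k => if k ∈ l then [] else S k)
        (l.length * (2 * L + 2) + 1) := by
  induction l with
  | nil => exact fun v S _ => ⟨v, rfl, .mono (runs_skipC _) (by simp)⟩
  | cons k l ih =>
    intro v S hL
    obtain ⟨v₁, h₁, r₁⟩ := runs_clear k v S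
    obtain ⟨v', h', r'⟩ := ih v₁ (Function.update S k []) (by
      intro k'
      by_cases hk : k' = k
      · subst hk
        simp
      · simpa [hk] using hL k')
    refine ⟨v', h'.trans h₁, ?_⟩
    have e : (fun k' => if k' ∈ l then [] else Function.update S k [] k') =
        fun k' => if k' ∈ k :: l then [] else S k' := by
      funext k'
      by_cases hk : k' = k
      · subst hk
        simp
      · simp [hk]
    rw [e] at r'
    refine .mono (r₁.seq r') ?_
    have := hL k
    simp only [List.length_cons, Nat.succ_mul]
    omega

/-- The whole computation: copy the input to the heads, evaluate the formula with the whole word as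
the value of its free variables, clean up, and output the truth value. -/
noncomputable def decideC (D : ℕ) (φ : Fm A) : HeadCmd A (D + 1) :=
  .seq (.seq (copyInput (D + 1)) (rewind (hd D 0)))
    (.seq (prog D 1 φ)
      (.seq (seqs ((Finset.univ : Finset (Stk (D + 1))).toList.map clear))
        (.seq (.prim (.push .out fun v => v.1)) (.prim (.load fun _ => (false, none, none))))))

/-- The stacks at the end of the computation. -/
def result {H : ℕ} (b : Bool) : Stacks A H
  | .out => [b]
  | .inp => []
  | .ctr => []
  | .left _ => []
  | .right _ => []

/-- The bound for the number of steps of the whole computation. -/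
noncomputable def decideTime (D : ℕ) (φ : Fm A) : Polynomial ℕ :=
  ((.X * ((D + 1 : ℕ) + 4) + 4) + (4 * .X + 2)) + (φ.time +
    (((Fintype.card (Stk (D + 1)) : ℕ) * (2 * .X + 2) + 1) + (1 + 1)))

open Classical in
theorem runs_decideC (φ : Fm A) (w : List A) :
    Runs (decideC φ.depth φ) ((false, none, none), copying [] w)
      ((false, none, none), result (decide (φ.Holds w fun _ => w)))
      ((decideTime φ.depth φ).eval w.length) := by
  set D := φ.depth
  obtain ⟨v₁, r₁⟩ := runs_copyInput (D + 1) w (false, none, none)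
  have hS₁ : Reads w (copying w [] : Stacks A (D + 1)) :=
    ⟨fun h => by simp [Stacks.pre, Stacks.suf, copying], rfl, rfl, rfl⟩
  obtain ⟨v₂, S₂, r₂, hS₂, hw₂, -⟩ := runs_rewind (hd D 0) v₁ _ hS₁
  obtain ⟨v₃, S₃, r₃, hS₃, -, hv₃⟩ := evaluates_prog D φ 1 one_pos (by omega) w v₂ S₂ hS₂
  have hval : val D 1 S₂ = fun _ => w := by
    funext i
    simp [val, hw₂]
  rw [hval] at hv₃
  obtain ⟨v₄, h₄, r₄⟩ := runs_clears w.length (Finset.univ : Finset (Stk (D + 1))).toList v₃ S₃ (by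
    intro k
    cases k with
    | inp => rw [hS₃.inp]; simp
    | out => rw [hS₃.out]; simp
    | ctr => rw [hS₃.ctr]; simp
    | left h =>
      change (S₃.pre h).length ≤ _
      rw [← hS₃.zip h]
      simp
    | right h => exact (hS₃.suf_suffix h).length_le)
  have r₅ := Runs.prim (.push .out fun v => v.1 : HeadPrim A (D + 1))
    (v₄, fun k => if k ∈ (Finset.univ : Finset (Stk (D + 1))).toList then [] else S₃ k)
  have r₆ := Runs.prim (.load fun _ => (false, none, none) : HeadPrim A (D + 1))
    ((.push .out fun v => v.1 : HeadPrim A (D + 1)).run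
      (v₄, fun k => if k ∈ (Finset.univ : Finset (Stk (D + 1))).toList then [] else S₃ k))
  unfold decideC
  convert ((r₁.seq r₂).seq (r₃.seq (r₄.seq (r₅.seq r₆)))) using 1
  · refine Prod.ext rfl (Stacks.ext_iff.2 ⟨fun h => ?_, fun h => ?_, ?_, ?_, ?_⟩)
    · simp [Prim.run, Stacks.pre, result]
    · simp [Prim.run, Stacks.suf, result]
    · simp [Prim.run, result]
    · have : decide (φ.Holds w fun _ => w) = v₃.1 := by
        rw [Bool.eq_iff_iff, decide_eq_true_iff]
        exact hv₃.symm
      simp [Prim.run, result, this, h₄]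
    · simp [Prim.run, result]
  · simp [decideTime]

variable [Fintype A]

/-- The machine that decides the formula `φ`. -/
noncomputable def deciderTM (φ : Fm A) : Turing.FinTM2 :=
  haveI := (decideC φ.depth φ).fintypeLab
  { K := Stk (φ.depth + 1)
    k₀ := .inp
    k₁ := .out
    Γ := Alph A
    Λ := Option (decideC φ.depth φ).Lab
    main := some (decideC φ.depth φ).entry
    σ := Reg A
    initialState := (false, none, none)
    Γk₀Fin := inferInstanceAs (Fintype A)
    m := (decideC φ.depth φ).machine }

theorem initList_deciderTM (φ : Fm A) (w : List A) :
    Turing.initList (deciderTM φ) w =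
      ⟨some (some (decideC φ.depth φ).entry), (false, none, none), copying [] w⟩ := by
  have : (Turing.initList (deciderTM φ) w).stk = (copying [] w : Stacks A (φ.depth + 1)) :=
    Stacks.ext_iff.2 ⟨fun _ => rfl, fun _ => rfl, rfl, rfl, rfl⟩
  rw [← this]
  rfl

theorem haltList_deciderTM (φ : Fm A) (b : Bool) :
    Turing.haltList (deciderTM φ) [b] = ⟨none, (false, none, none), result b⟩ := by
  have : (Turing.haltList (deciderTM φ) [b]).stk = (result b : Stacks A (φ.depth + 1)) :=
    Stacks.ext_iff.2 ⟨fun _ => rfl, fun _ => rfl, rfl, rfl, rfl⟩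
  rw [← this]
  rfl

/-- A decision problem can be solved in polynomial time if its yes-instances are described by a
first-order formula about the encoding. -/
theorem polyTime_of_formula {α : Type} (enc : α → List A) (f : α → Bool) (φ : Fm A)
    (h : ∀ a, f a = true ↔ φ.Holds (enc a) fun _ => enc a) :
    Nonempty (Turing.TM2ComputableInPolyTime enc Computability.encodeBool f) := by
  classical
  refine ⟨{ tm := deciderTM φ
            inputAlphabet := Equiv.refl A
            outputAlphabet := Equiv.refl Bool
            time := decideTime φ.depth φ + 1
            outputsFun := fun a => Classical.choice ?_ }⟩
  obtain ⟨m, hm, e⟩ := (runs_decideC φ (enc a)).reach_machine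
  have hf : decide (φ.Holds (enc a) fun _ => enc a) = f a := by
    rw [Bool.eq_iff_iff, decide_eq_true_iff]
    exact (h a).symm
  refine ⟨⟨⟨m, ?_⟩, by simpa using hm⟩⟩
  rw [hf] at e
  have h₁ : List.map (Equiv.refl A).invFun (enc a) = enc a := List.map_id _
  have h₂ : List.map (Equiv.refl Bool).invFun (Computability.encodeBool (f a)) = [f a] := rfl
  exact (congrArg₂ (fun x y =>
    (flip bind (Turing.FinTM2.step (deciderTM φ)))^[m] (some x) = some y)
    ((congrArg (Turing.initList (deciderTM φ)) h₁).trans (initList_deciderTM φ (enc a)))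
    ((congrArg (Turing.haltList (deciderTM φ)) h₂).trans (haltList_deciderTM φ (f a)))).mpr e

end StackProgram

/-! ### Formulas about suffixes, tokens and records -/

namespace StackProgram

open Computability

section Generic

variable {A : Type}

theorem scan_of_some {f : Option A → Option A → Option Bool} {x y : List A} {r : Bool}
    (h : f x.head? y.head? = some r) : scan f x y = r := by
  cases x <;> cases y <;> simp_all [scan]

/-- The formula that is always true. -/
def Fm.top : Fm A := .scan (fun _ _ => some true) 0 0

/-- Disjunction. -/
def Fm.or (φ ψ : Fm A) : Fm A := .not (.and (.not φ) (.not ψ))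

/-- Implication. -/
def Fm.imp (φ ψ : Fm A) : Fm A := .not (.and φ (.not ψ))

/-- The conjunction of a list of formulas. -/
def Fm.conj : List (Fm A) → Fm A
  | [] => .top
  | φ :: l => .and φ (Fm.conj l)

/-- The disjunction of a list of formulas. -/
def Fm.disj (l : List (Fm A)) : Fm A := .not (.conj (l.map .not))

/-- A block of `m` existential quantifiers. -/
def Fm.exs : ℕ → Fm A → Fm A
  | 0, φ => φ
  | m + 1, φ => .ex (Fm.exs m φ)

/-- A block of `m` universal quantifiers. -/
def Fm.alls (m : ℕ) (φ : Fm A) : Fm A := .not (.exs m (.not φ))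

/-- Add values for the variables with the indices below `l.length` to a valuation. -/
def vapp : List (List A) → (ℕ → List A) → ℕ → List A
  | [], ν => ν
  | s :: l, ν => vcons s (vapp l ν)

theorem vapp_append (l l' : List (List A)) (ν : ℕ → List A) :
    vapp (l ++ l') ν = vapp l (vapp l' ν) := by
  induction l with
  | nil => rfl
  | cons s l ih => rw [List.cons_append, vapp, vapp, ih]

theorem vapp_add (l : List (List A)) (ν : ℕ → List A) (i : ℕ) :
    vapp l ν (i + l.length) = ν i := by
  induction l with
  | nil => rfl
  | cons s l ih => exact ih

theorem map_range_vapp (l : List (List A)) (ν : ℕ → List A) :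
    (List.range l.length).map (vapp l ν) = l := by
  induction l with
  | nil => rfl
  | cons s l ih =>
    rw [List.length_cons, List.range_succ_eq_map, List.map_cons, List.map_map]
    exact congrArg _ ih

variable {w : List A} {ν : ℕ → List A} {φ ψ : Fm A}

theorem Fm.holds_not : (Fm.not φ).Holds w ν ↔ ¬ φ.Holds w ν := Iff.rfl

theorem Fm.holds_and : (Fm.and φ ψ).Holds w ν ↔ φ.Holds w ν ∧ ψ.Holds w ν := Iff.rfl

theorem Fm.holds_ex : (Fm.ex φ).Holds w ν ↔ ∃ s, s <:+ w ∧ φ.Holds w (vcons s ν) := Iff.rfl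

theorem Fm.holds_top : (Fm.top : Fm A).Holds w ν ↔ True := by
  simp only [top, Holds, iff_true]
  exact scan_of_some rfl

theorem Fm.holds_or : (Fm.or φ ψ).Holds w ν ↔ φ.Holds w ν ∨ ψ.Holds w ν := by
  simp only [Fm.or, Holds]
  tauto

theorem Fm.holds_imp : (Fm.imp φ ψ).Holds w ν ↔ (φ.Holds w ν → ψ.Holds w ν) := by
  simp only [Fm.imp, Holds]
  tauto

theorem Fm.holds_conj {l : List (Fm A)} : (Fm.conj l).Holds w ν ↔ ∀ φ ∈ l, φ.Holds w ν := by
  induction l with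
  | nil => simp [conj, holds_top]
  | cons φ l ih => simp [conj, holds_and, ih]

theorem Fm.holds_disj {l : List (Fm A)} : (Fm.disj l).Holds w ν ↔ ∃ φ ∈ l, φ.Holds w ν := by
  simp [disj, holds_not, holds_conj]

theorem Fm.holds_exs {m : ℕ} : (Fm.exs m φ).Holds w ν ↔
    ∃ l : List (List A), l.length = m ∧ (∀ s ∈ l, s <:+ w) ∧ φ.Holds w (vapp l ν) := by
  induction m generalizing ν with
  | zero =>
    simp only [exs, List.length_eq_zero_iff, exists_eq_left, vapp]
    simp
  | succ m ih =>
    simp only [exs, holds_ex, ih]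
    constructor
    · rintro ⟨s, hs, l, rfl, hl, h⟩
      refine ⟨l ++ [s], by simp, ?_, by rwa [vapp_append]⟩
      intro s' hs'
      rcases List.mem_append.1 hs' with h' | h'
      · exact hl s' h'
      · rwa [List.mem_singleton.1 h']
    · rintro ⟨l, hlen, hl, h⟩
      obtain ⟨l', s, rfl⟩ : ∃ l' s, l = l' ++ [s] :=
        ⟨_, _, (List.dropLast_append_getLast (List.ne_nil_of_length_eq_add_one hlen)).symm⟩
      rw [vapp_append] at h
      exact ⟨s, hl s (by simp), l', by simpa using hlen, fun s' hs' => hl s' (by simp [hs']), h⟩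

theorem Fm.holds_alls {m : ℕ} : (Fm.alls m φ).Holds w ν ↔
    ∀ l : List (List A), l.length = m → (∀ s ∈ l, s <:+ w) → φ.Holds w (vapp l ν) := by
  simp [alls, holds_not, holds_exs]

/-- The suffix `i` is longer than the suffix `j`. -/
def Fm.longer (i j : ℕ) : Fm A :=
  .scan (fun a b => if a.isSome && b.isNone then some true else none) i j

theorem Fm.holds_longer {i j : ℕ} :
    (Fm.longer i j).Holds w ν ↔ (ν j).length < (ν i).length := by
  simp only [longer, Holds]
  generalize ν i = x, ν j = y
  induction x generalizing y with
  | nil => simp [StackProgram.scan]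
  | cons a x ih =>
    cases y with
    | nil => simp [StackProgram.scan]
    | cons b y =>
      simp only [StackProgram.scan]
      simpa using ih y

variable [DecidableEq A]

/-- The suffix `i` begins with the symbol `c`. -/
def Fm.sym (c : A) (i : ℕ) : Fm A := .scan (fun a _ => some (decide (a = some c))) i i

theorem Fm.holds_sym {c : A} {i : ℕ} : (Fm.sym c i).Holds w ν ↔ (ν i).head? = some c := by
  simp only [sym, Holds]
  rw [scan_of_some rfl, decide_eq_true_iff]

/-- The suffix `j` arises from the suffix `i` by deleting one symbol. -/
def Fm.tail (i j : ℕ) : Fm A :=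
  .and (.longer i j) (.not (.ex (.and (.longer (i + 1) 0) (.longer 0 (j + 1)))))

omit [DecidableEq A] in
theorem Fm.holds_tail {i j : ℕ} (hi : ν i <:+ w) (hj : ν j <:+ w) :
    (Fm.tail i j).Holds w ν ↔ ∃ a, ν i = a :: ν j := by
  simp only [tail, holds_and, holds_not, holds_ex, holds_longer, vcons]
  constructor
  · rintro ⟨h₁, h₂⟩
    cases e : ν i with
    | nil => simp [e] at h₁
    | cons a x =>
      rw [e] at h₁ h₂ hi
      have hx : x <:+ w := (List.suffix_cons a x).trans hi
      refine ⟨a, ?_⟩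
      have hle : x.length ≤ (ν j).length := by
        by_contra hlt
        exact h₂ ⟨x, hx, by simp, by omega⟩
      rw [(List.suffix_of_suffix_length_le hx hj hle).eq_of_length_le
        (by simpa [Nat.lt_succ_iff] using h₁)]
  · rintro ⟨a, e⟩
    rw [e]
    refine ⟨by simp, ?_⟩
    rintro ⟨s, -, h₁, h₂⟩
    simp only [List.length_cons] at h₁
    omega

omit [DecidableEq A] in
theorem eq_of_append_cons_eq {c : A} {t t' r r' : List A} (ht : c ∉ t) (ht' : c ∉ t')
    (h : t ++ c :: r = t' ++ c :: r') : t = t' ∧ r = r' := by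
  induction t generalizing t' with
  | nil =>
    cases t' with
    | nil => exact ⟨rfl, (List.cons.inj h).2⟩
    | cons b t' => exact absurd (List.cons.inj h).1 fun e => ht' (e ▸ List.mem_cons_self)
  | cons a t ih =>
    cases t' with
    | nil => exact absurd (List.cons.inj h).1 fun e => ht (e ▸ List.mem_cons_self)
    | cons b t' =>
      simp only [List.cons_append, List.cons.injEq] at h
      obtain ⟨rfl, h⟩ := h
      obtain ⟨rfl, rfl⟩ := ih (fun h' => ht (by simp [h'])) (fun h' => ht' (by simp [h'])) h
      exact ⟨rfl, rfl⟩

/-- The suffix `j` begins just after the first `c` in the suffix `i`. -/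
def Fm.after (c : A) (i j : ℕ) : Fm A :=
  .ex (.and (.and (.not (.longer 0 (i + 1))) (.sym c 0)) (.and (.tail 0 (j + 1))
    (.not (.ex (.and (.not (.longer 0 (i + 2))) (.and (.longer 0 1) (.sym c 0)))))))

theorem Fm.holds_after {c : A} {i j : ℕ} (hi : ν i <:+ w) (hj : ν j <:+ w) :
    (Fm.after c i j).Holds w ν ↔ ∃ t, c ∉ t ∧ ν i = t ++ c :: ν j := by
  simp only [after]
  rw [holds_ex]
  constructor
  · rintro ⟨s, hs, h⟩
    simp only [holds_and, holds_not, holds_ex, holds_longer, holds_sym, vcons, not_lt] at h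
    obtain ⟨⟨h₁, h₂⟩, h₃, h₄⟩ := h
    obtain ⟨a, ha⟩ := (Fm.holds_tail (ν := vcons s ν) (i := 0) (j := j + 1) hs hj).1 h₃
    simp only [vcons] at ha
    obtain rfl : a = c := by simpa [ha] using h₂
    obtain ⟨t, ht⟩ := List.suffix_of_suffix_length_le hs hi h₁
    refine ⟨t, fun hc => h₄ ?_, by rw [← ht, ha]⟩
    obtain ⟨t₁, t₂, rfl⟩ := List.append_of_mem hc
    have hx : a :: t₂ ++ s <:+ ν i := ⟨t₁, by rw [← ht]; simp⟩
    exact ⟨a :: t₂ ++ s, hx.trans hi, hx.length_le, by simp, by simp⟩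
  · rintro ⟨t, ht, e⟩
    have hs : c :: ν j <:+ ν i := ⟨t, e.symm⟩
    refine ⟨c :: ν j, hs.trans hi, ?_⟩
    simp only [holds_and, holds_not, holds_ex, holds_longer, holds_sym, vcons, not_lt]
    refine ⟨⟨hs.length_le, by simp⟩,
      (Fm.holds_tail (ν := vcons (c :: ν j) ν) (i := 0) (j := j + 1) (hs.trans hi) hj).2
        ⟨c, rfl⟩, ?_⟩
    rintro ⟨u, hu, h₁, h₂, h₃⟩
    obtain ⟨t₂, ht₂⟩ := List.suffix_of_suffix_length_le (hs.trans hi) hu h₂.le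
    obtain ⟨t₁, ht₁⟩ := List.suffix_of_suffix_length_le hu hi h₁
    cases t₂ with
    | nil =>
      rw [← ht₂] at h₂
      simp at h₂
    | cons b t₂ =>
      rw [← ht₂] at h₃
      obtain rfl : b = c := by simpa using h₃
      rw [← ht₂, e, ← List.append_assoc] at ht₁
      have := List.append_cancel_right ht₁
      exact ht (by rw [← this]; simp)

/-- The suffix `i` begins with the token `t`, terminated by `c`. -/
def Fm.tokIs (c : A) : List A → ℕ → Fm A
  | [], i => .sym c i
  | a :: t, i => .and (.sym a i) (.ex (.and (.tail (i + 1) 0) (Fm.tokIs c t 0)))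

theorem Fm.holds_tokIs {c : A} {t : List A} {i : ℕ} (hi : ν i <:+ w) :
    (Fm.tokIs c t i).Holds w ν ↔ t ++ [c] <+: ν i := by
  induction t generalizing ν i with
  | nil =>
    rw [tokIs, holds_sym]
    cases ν i <;> simp [eq_comm]
  | cons a t ih =>
    rw [tokIs, holds_and, holds_sym, holds_ex]
    constructor
    · rintro ⟨h₁, s, hs, h₂, h₃⟩
      obtain ⟨b, hb⟩ := (Fm.holds_tail (ν := vcons s ν) (i := i + 1) (j := 0) hi hs).1 h₂
      have h₃ := (ih (ν := vcons s ν) (i := 0) hs).1 h₃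
      simp only [vcons] at hb h₃
      rw [hb] at h₁ ⊢
      obtain rfl : b = a := by simpa using h₁
      simpa using h₃
    · rintro ⟨r, hr⟩
      have hs : (t ++ [c]) ++ r <:+ ν i := ⟨[a], by rw [← hr]; simp⟩
      refine ⟨by rw [← hr]; simp, (t ++ [c]) ++ r, hs.trans hi,
        (Fm.holds_tail (ν := vcons _ ν) (i := i + 1) (j := 0) hi (hs.trans hi)).2
          ⟨a, by simp [vcons, ← hr]⟩, (ih (ν := vcons _ ν) (i := 0) (hs.trans hi)).2
          (List.prefix_append _ _)⟩

/-- The suffixes `i` and `j` begin with the same token, terminated by `c`. -/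
def Fm.tokEq (c : A) (i j : ℕ) : Fm A :=
  .scan (fun a b => if a = b then (if a = some c then some true else none) else some false) i j

theorem Fm.holds_tokEq {c : A} {i j : ℕ} {t t' r r' : List A} (ht : c ∉ t) (ht' : c ∉ t')
    (hi : ν i = t ++ c :: r) (hj : ν j = t' ++ c :: r') :
    (Fm.tokEq c i j).Holds w ν ↔ t = t' := by
  simp only [tokEq, Holds]
  rw [hi, hj]
  clear hi hj
  induction t generalizing t' with
  | nil =>
    cases t' with
    | nil => simp [StackProgram.scan]
    | cons b t' =>
      have : c ≠ b := by simp_all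
      simp [StackProgram.scan, this]
  | cons a t ih =>
    have ha : a ≠ c := by
      rintro rfl
      simp at ht
    cases t' with
    | nil => simp [StackProgram.scan, ha]
    | cons b t' =>
      by_cases hab : a = b
      · subst hab
        simp only [List.cons_append, StackProgram.scan, if_true, Option.some.injEq, ha, if_false,
          Option.getD_none, List.cons.injEq, true_and]
        exact ih (fun h' => ht (by simp [h'])) (fun h' => ht' (by simp [h']))
      · simp [StackProgram.scan, hab]

/-- Tokens, each followed by the separator `c`. -/
def flat (c : A) (ts : List (List A)) : List A := ts.flatMap (· ++ [c])

omit [DecidableEq A] in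
theorem flat_cons (c : A) (t : List A) (ts : List (List A)) (r : List A) :
    flat c (t :: ts) ++ r = t ++ c :: (flat c ts ++ r) := by
  simp [flat]

omit [DecidableEq A] in
theorem flat_drop_eq {c : A} {ts : List (List A)} {f : ℕ} {t : List A} (h : ts[f]? = some t)
    (r : List A) :
    flat c (ts.drop f) ++ r = t ++ c :: (flat c (ts.drop (f + 1)) ++ r) := by
  obtain ⟨hf, rfl⟩ := List.getElem?_eq_some_iff.1 h
  rw [List.drop_eq_getElem_cons hf, flat_cons]

/-- The word `x` consists of a symbol, the tokens `ts` with separator `c`, and a remainder `r`. -/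
structure IsRecord (c : A) (x : List A) (ts : List (List A)) (r : List A) : Prop where
  eq : ∃ a, x = a :: (flat c ts ++ r)
  free : ∀ t ∈ ts, c ∉ t

/-- The suffix `j` begins at the field with number `f` of the record at the suffix `i`. -/
def Fm.field (c : A) : ℕ → ℕ → ℕ → Fm A
  | 0, i, j => .tail i j
  | f + 1, i, j => .ex (.and (Fm.field c f (i + 1) 0) (.after c 0 (j + 1)))

theorem Fm.holds_field {c : A} {f i j : ℕ} {ts : List (List A)} {r : List A} (hi : ν i <:+ w)
    (hj : ν j <:+ w) (h : IsRecord c (ν i) ts r) (hf : f ≤ ts.length) :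
    (Fm.field c f i j).Holds w ν ↔ ν j = flat c (ts.drop f) ++ r := by
  obtain ⟨a, ha⟩ := h.eq
  induction f generalizing ν i j with
  | zero =>
    rw [field, holds_tail hi hj, ha]
    simp [eq_comm]
  | succ f ih =>
    rw [field, holds_ex]
    have hd' : flat c (ts.drop f) ++ r = ts[f] ++ c :: (flat c (ts.drop (f + 1)) ++ r) :=
      flat_drop_eq (List.getElem?_eq_getElem (by omega)) r
    have hfree : c ∉ ts[f] := h.free _ (List.getElem_mem _)
    constructor
    · rintro ⟨s, hs, h₁, h₂⟩
      have h₁ := (ih (ν := vcons s ν) (i := i + 1) (j := 0) hi hs h (by omega) ha).1 h₁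
      obtain ⟨t, ht, e⟩ := (Fm.holds_after (ν := vcons s ν) (i := 0) (j := j + 1) hs hj).1 h₂
      simp only [vcons] at h₁ e
      rw [h₁, hd'] at e
      exact (eq_of_append_cons_eq hfree ht e).2.symm
    · intro e
      have hs : flat c (ts.drop f) ++ r <:+ w := by
        refine List.IsSuffix.trans ⟨a :: flat c (ts.take f), ?_⟩ hi
        rw [ha, ← List.append_assoc, List.cons_append, flat, flat, flat, ← List.flatMap_append,
          List.take_append_drop, List.cons_append]
      refine ⟨flat c (ts.drop f) ++ r, hs,
        (ih (ν := vcons _ ν) (i := i + 1) (j := 0) hi hs h (by omega) ha).2 rfl,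
        (Fm.holds_after (ν := vcons _ ν) (i := 0) (j := j + 1) hs hj).2 ⟨ts[f], hfree, ?_⟩⟩
      simp only [vcons]
      rw [e, hd']

omit [DecidableEq A] in
theorem IsRecord.suffix_field {c : A} {x : List A} {ts : List (List A)} {r : List A}
    (h : IsRecord c x ts r) (f : ℕ) : flat c (ts.drop f) ++ r <:+ x := by
  obtain ⟨a, ha⟩ := h.eq
  refine ⟨a :: flat c (ts.take f), ?_⟩
  rw [ha, ← List.append_assoc, List.cons_append, flat, flat, flat, ← List.flatMap_append,
    List.take_append_drop, List.cons_append]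

/-- `φ` holds for the field with number `f` of the record at the suffix `i`; in `φ`, the suffix
at which the field begins has the index `0`. -/
def Fm.atField (c : A) (f i : ℕ) (φ : Fm A) : Fm A := .ex (.and (.field c f (i + 1) 0) φ)

theorem Fm.holds_atField {c : A} {f i : ℕ} {ts : List (List A)} {r : List A} (hi : ν i <:+ w)
    (h : IsRecord c (ν i) ts r) (hf : f ≤ ts.length) :
    (Fm.atField c f i φ).Holds w ν ↔ φ.Holds w (vcons (flat c (ts.drop f) ++ r) ν) := by
  have hs := (h.suffix_field f).trans hi
  rw [atField, holds_ex]
  constructor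
  · rintro ⟨s, hs', h₁, h₂⟩
    obtain rfl : s = _ := (Fm.holds_field (ν := vcons s ν) (i := i + 1) (j := 0) hi hs' h hf).1 h₁
    exact h₂
  · exact fun h₂ => ⟨_, hs,
      (Fm.holds_field (ν := vcons _ ν) (i := i + 1) (j := 0) hi hs h hf).2 rfl, h₂⟩

/-- The field `f` of the record at `i` begins with the symbol `a`. -/
def Fm.fieldSym (c a : A) (f i : ℕ) : Fm A := .atField c f i (.sym a 0)

/-- The field `f` of the record at `i` is the token `t`. -/
def Fm.fieldIs (c : A) (t : List A) (f i : ℕ) : Fm A := .atField c f i (.tokIs c t 0)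

/-- The field `f` of the record at `i` equals the field `g` of the record at `j`. -/
def Fm.fieldEq (c : A) (f i g j : ℕ) : Fm A :=
  .atField c f i (.atField c g (j + 1) (.tokEq c 1 0))

theorem Fm.holds_fieldSym {c a : A} {f i : ℕ} {ts : List (List A)} {r : List A} (hi : ν i <:+ w)
    (h : IsRecord c (ν i) ts r) (hf : f ≤ ts.length) :
    (Fm.fieldSym c a f i).Holds w ν ↔ (flat c (ts.drop f) ++ r).head? = some a := by
  rw [fieldSym, holds_atField hi h hf, holds_sym]
  rfl

theorem Fm.holds_fieldIs {c : A} {t t' : List A} {f i : ℕ} {ts : List (List A)} {r : List A}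
    (hi : ν i <:+ w) (h : IsRecord c (ν i) ts r) (hf : ts[f]? = some t) (ht' : c ∉ t') :
    (Fm.fieldIs c t' f i).Holds w ν ↔ t = t' := by
  obtain ⟨hf', -⟩ := List.getElem?_eq_some_iff.1 hf
  rw [fieldIs, holds_atField hi h hf'.le, holds_tokIs (by exact (h.suffix_field f).trans hi)]
  change _ <+: flat c (ts.drop f) ++ r ↔ _
  rw [flat_drop_eq hf]
  constructor
  · rintro ⟨r', e⟩
    rw [List.append_assoc, List.singleton_append] at e
    exact (eq_of_append_cons_eq ht' (h.free t (List.mem_of_getElem? hf)) e).1.symm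
  · rintro rfl
    exact ⟨_, by simp; rfl⟩

theorem Fm.holds_fieldEq {c : A} {t t' : List A} {f i g j : ℕ} {ts ts' : List (List A)}
    {r r' : List A} (hi : ν i <:+ w) (hj : ν j <:+ w) (h : IsRecord c (ν i) ts r)
    (h' : IsRecord c (ν j) ts' r') (hf : ts[f]? = some t) (hg : ts'[g]? = some t') :
    (Fm.fieldEq c f i g j).Holds w ν ↔ t = t' := by
  obtain ⟨hf', -⟩ := List.getElem?_eq_some_iff.1 hf
  obtain ⟨hg', -⟩ := List.getElem?_eq_some_iff.1 hg
  rw [fieldEq, holds_atField hi h hf'.le,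
    Fm.holds_atField (ν := vcons _ ν) (i := j + 1) hj h' hg'.le]
  exact Fm.holds_tokEq (h.free t (List.mem_of_getElem? hf)) (h'.free t' (List.mem_of_getElem? hg))
    (flat_drop_eq hf r) (flat_drop_eq hg r')

end Generic

end StackProgram

/-! ### Runs of finite state machines -/

namespace MultiPort

open StackProgram Computability

/-- The type of the transitions of an FSM with `m` states. -/
abbrev Transition {n : ℕ} (a b : Fin n → ℕ) (m : ℕ) : Type :=
  Fin m × Fin m × Input (fun p => Fin (a p)) × Output (fun p => Fin (b p))

section Runs

variable {n : ℕ} {a b : Fin n → ℕ}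

/-- The transitions `ts` form a path that starts in the state `s`. -/
def Linked {m : ℕ} : Fin m → List (Transition a b m) → Prop
  | _, [] => True
  | s, t :: ts => t.1 = s ∧ Linked t.2.1 ts

/-- The label of a sequence of transitions. -/
def label {m : ℕ} (ts : List (Transition a b m)) :
    Trace (fun p => Fin (a p)) (fun p => Fin (b p)) := ts.map fun t => t.2.2

theorem FSMDesc.exists_path_iff (D : FSMDesc a b) (s : Fin D.numStates)
    (σ : Trace (fun p => Fin (a p)) (fun p => Fin (b p))) :
    (∃ s', D.toFSM.Path s σ s') ↔ ∃ ts, (∀ t ∈ ts, t ∈ D.trans) ∧ Linked s ts ∧ label ts = σ := by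
  constructor
  · have key : ∀ (s s' : D.toFSM.State) (σ : Trace _ _), D.toFSM.Path s σ s' →
        ∃ ts, (∀ t ∈ ts, t ∈ D.trans) ∧ Linked (m := D.numStates) s ts ∧ label ts = σ := by
      intro s s' σ h
      induction h with
      | nil s => exact ⟨[], by simp, trivial, rfl⟩
      | @cons s s₁ s₂ x y σ h _ ih =>
        obtain ⟨ts, h₁, h₂, rfl⟩ := ih
        refine ⟨(s, s₁, x, y) :: ts, ?_, ⟨rfl, h₂⟩, rfl⟩
        exact List.forall_mem_cons.2 ⟨h, h₁⟩
    rintro ⟨s', h⟩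
    exact key s s' σ h
  · rintro ⟨ts, h₁, h₂, rfl⟩
    induction ts generalizing s with
    | nil => exact ⟨s, FSM.Path.nil (M := D.toFSM) s⟩
    | cons t ts ih =>
      obtain ⟨rfl, h₂⟩ := h₂
      obtain ⟨s', h'⟩ := ih t.2.1 (fun t' ht' => h₁ t' (by simp [ht'])) h₂
      exact ⟨s', .cons (M := D.toFSM) (h₁ t (by simp)) h'⟩

variable {I O : Fin n → Type}

/-- The number of inputs in a global trace can be read off from its projections. -/
theorem sum_countP_proj (σ : Trace I O) :
    ∑ p, (proj p σ).countP Sum.isLeft = σ.length := by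
  induction σ with
  | nil => simp [proj]
  | cons e σ ih =>
    obtain ⟨x, y⟩ := e
    have hin : ∀ p, (inputAt (O := O) p x).countP Sum.isLeft = if x.1 = p then 1 else 0 := by
      intro p
      unfold inputAt
      split_ifs <;> simp
    have hout : ∀ p, (outputAt (I := I) p y).countP Sum.isLeft = 0 := by
      intro p
      unfold outputAt
      split <;> simp
    simp only [proj, List.countP_append, hin, hout, Finset.sum_add_distrib, ih]
    simp [add_comm]

theorem Indist.length_eq {σ σ' : Trace I O} (h : Indist σ σ') : σ.length = σ'.length := by
  rw [← sum_countP_proj, ← sum_countP_proj]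
  exact Finset.sum_congr rfl fun p _ => by rw [h p]

/-- Conformance in terms of sequences of transitions. Since indistinguishable traces have the same
length, only sequences of the specification of the same length have to be considered. -/
theorem stronglyConforms_iff (k : ℕ) (N M : FSMDesc a b) :
    StronglyConformsUpTo k N.toFSM M.toFSM ↔ ∀ m ≤ k, ∀ ts : List (Transition a b N.numStates),
      ts.length = m → (∀ t ∈ ts, t ∈ N.trans) → Linked N.init ts →
      ∃ ts' : List (Transition a b M.numStates), ts'.length = m ∧ (∀ t ∈ ts', t ∈ M.trans) ∧
        Linked M.init ts' ∧ ∀ p, proj p (label ts) = proj p (label ts') := by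
  constructor
  · intro h m hm ts hlen hts hl
    obtain ⟨σ', h', hi⟩ := h (label ts)
      ⟨(N.exists_path_iff _ _).2 ⟨ts, hts, hl, rfl⟩, by simpa [label, hlen] using hm⟩
    obtain ⟨ts', hts', hl', rfl⟩ := (M.exists_path_iff _ _).1 h'
    refine ⟨ts', ?_, hts', hl', fun p => (hi p).symm⟩
    simpa [label, hlen] using hi.length_eq
  · rintro h σ ⟨hσ, hlen⟩
    obtain ⟨ts, hts, hl, rfl⟩ := (N.exists_path_iff _ _).1 hσ
    obtain ⟨ts', -, hts', hl', hp⟩ := h ts.length (by simpa [label] using hlen) ts rfl hts hl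
    exact ⟨label ts', (M.exists_path_iff _ _).2 ⟨ts', hts', hl', rfl⟩, fun p => (hp p).symm⟩

/-- The observation at the port `p` made in a transition: the input (for the kind `true`) or the
output (for the kind `false`), provided that there is one at this port. -/
def observation {m : ℕ} (p : Fin n) : Bool × Transition a b m → Option (Fin (a p) ⊕ Fin (b p))
  | (true, t) => if h : t.2.2.1.1 = p then some (Sum.inl (h ▸ t.2.2.1.2)) else none
  | (false, t) => (t.2.2.2 p).map Sum.inr

/-- The inputs and the outputs of a sequence of transitions, in the order in which they occur. -/
def slots {α : Type} (l : List α) : List (Bool × α) := l.flatMap fun x => [(true, x), (false, x)]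

theorem proj_label {m : ℕ} (p : Fin n) (ts : List (Transition a b m)) :
    proj p (label ts) = (slots ts).filterMap (observation p) := by
  induction ts with
  | nil => rfl
  | cons t ts ih =>
    change inputAt (I := fun p => Fin (a p)) (O := fun p => Fin (b p)) p t.2.2.1 ++
      (outputAt (I := fun p => Fin (a p)) (O := fun p => Fin (b p)) p t.2.2.2 ++
        proj p (label ts)) =
      List.filterMap (observation p) ([(true, t), (false, t)] ++ slots ts)
    rw [ih, List.filterMap_append, ← List.append_assoc]
    congr 1
    unfold inputAt outputAt
    by_cases h : t.2.2.1.1 = p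
    · cases e : t.2.2.2 p <;> simp [observation, h, e]
    · cases e : t.2.2.2 p <;> simp [observation, h, e]

end Runs

/-! ### Transitions and machines as records -/

section Records

/-- The token of a number. -/
def tokN (m : ℕ) : List Γ' := (encodeNat m).map Γ'.bit

/-- The token of an output. -/
def tokO {m : ℕ} : Option (Fin m) → List Γ'
  | none => [Γ'.blank]
  | some z => tokN z

theorem tokN_injective : Function.Injective tokN := by
  intro m m' h
  have h' : encodeNat m = encodeNat m' :=
    List.map_injective_iff.2 (fun x y e => by simpa using e) h
  rw [← decode_encodeNat m, h', decode_encodeNat]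

theorem mem_tokN {m : ℕ} {c : Γ'} (h : c ∈ tokN m) : ∃ d, c = Γ'.bit d := by
  obtain ⟨d, -, rfl⟩ := List.mem_map.1 h
  exact ⟨d, rfl⟩

theorem comma_notMem_tokN (m : ℕ) : Γ'.comma ∉ tokN m := by
  intro h
  obtain ⟨d, hd⟩ := mem_tokN h
  cases hd

theorem tokN_ne_blank (m : ℕ) : tokN m ≠ [Γ'.blank] := by
  intro h
  obtain ⟨d, hd⟩ := mem_tokN (m := m) (c := Γ'.blank) (by simp [h])
  cases hd

theorem tokO_eq_blank_iff {m : ℕ} {z : Option (Fin m)} : tokO z = [Γ'.blank] ↔ z = none := by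
  cases z with
  | none => simp [tokO]
  | some z => simpa [tokO] using tokN_ne_blank z

theorem tokO_injective {m : ℕ} : Function.Injective (tokO (m := m)) := by
  intro z z' h
  cases z with
  | none => exact (tokO_eq_blank_iff.1 h.symm).symm
  | some z =>
    cases z' with
    | none => exact absurd h (tokN_ne_blank z)
    | some z' => exact congrArg some (Fin.ext (tokN_injective h))

theorem mem_tokO {m : ℕ} {z : Option (Fin m)} {c : Γ'} (h : c ∈ tokO z) :
    c ≠ Γ'.comma ∧ c ≠ Γ'.bra := by
  cases z with
  | none =>
    obtain rfl : c = Γ'.blank := by simpa [tokO] using h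
    simp
  | some z =>
    obtain ⟨d, rfl⟩ := mem_tokN h
    simp

theorem encNat_eq (m : ℕ) : encNat m = tokN m ++ [Γ'.comma] := rfl

theorem encOut_eq {m : ℕ} (z : Option (Fin m)) : encOut z = tokO z ++ [Γ'.comma] := by
  cases z <;> rfl

variable {n : ℕ} {a b : Fin n → ℕ}

/-- The tokens of a transition: the two states, the port and the number of the input, and the
outputs. -/
def toks {m : ℕ} (t : Transition a b m) : List (List Γ') :=
  [tokN t.1, tokN t.2.1, tokN t.2.2.1.1, tokN t.2.2.1.2] ++
    (List.finRange n).map fun p => tokO (t.2.2.2 p)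

theorem encTrans_eq {m : ℕ} (t : Transition a b m) :
    encTrans t = Γ'.bra :: (flat Γ'.comma (toks t) ++ [Γ'.ket]) := by
  simp [encTrans, flat, toks, encNat_eq, encOut_eq, List.flatMap_map]

theorem FSMDesc.encode_eq (D : FSMDesc a b) : D.encode = Γ'.bra ::
    (flat Γ'.comma [tokN D.numStates, tokN D.init] ++ (D.trans.flatMap encTrans ++ [Γ'.ket])) := by
  simp [FSMDesc.encode, flat, encNat_eq]

theorem toks_output {m : ℕ} (t : Transition a b m) (p : Fin n) :
    (toks t)[4 + (p : ℕ)]? = some (tokO (t.2.2.2 p)) := by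
  rw [toks, List.getElem?_append_right (by simp), List.getElem?_map]
  simp

theorem mem_toks {m : ℕ} {t : Transition a b m} {x : List Γ'} (h : x ∈ toks t) {c : Γ'}
    (hc : c ∈ x) : c ≠ Γ'.comma ∧ c ≠ Γ'.bra := by
  have hN : ∀ m, c ∈ tokN m → c ≠ Γ'.comma ∧ c ≠ Γ'.bra := by
    intro m h
    obtain ⟨d, rfl⟩ := mem_tokN h
    simp
  simp only [toks, List.mem_append, List.mem_cons, List.not_mem_nil, or_false, List.mem_map] at h
  rcases h with (rfl | rfl | rfl | rfl) | ⟨p, -, rfl⟩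
  · exact hN _ hc
  · exact hN _ hc
  · exact hN _ hc
  · exact hN _ hc
  · exact mem_tokO hc

theorem isRecord_encTrans {m : ℕ} (t : Transition a b m) (r : List Γ') :
    IsRecord Γ'.comma (encTrans t ++ r) (toks t) (Γ'.ket :: r) :=
  ⟨⟨Γ'.bra, by simp [encTrans_eq]⟩, fun _ h h' => (mem_toks h h').1 rfl⟩

theorem FSMDesc.isRecord_encode (D : FSMDesc a b) (r : List Γ') :
    IsRecord Γ'.comma (D.encode ++ r) [tokN D.numStates, tokN D.init]
      (D.trans.flatMap encTrans ++ Γ'.ket :: r) :=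
  ⟨⟨Γ'.bra, by simp [FSMDesc.encode_eq]⟩, by
    intro t h h'
    simp only [List.mem_cons, List.not_mem_nil, or_false] at h
    rcases h with rfl | rfl <;> exact comma_notMem_tokN _ h'⟩

/-! ### Where records begin -/

theorem suffix_of_bra {x A r : List Γ'} (h : x <:+ A ++ r) (hx : x.head? = some Γ'.bra)
    (hA : Γ'.bra ∉ A) : x <:+ r := by
  rcases List.suffix_or_suffix_of_suffix h (List.suffix_append A r) with h' | ⟨t, rfl⟩
  · exact h'
  · have ht : t <:+ A := by
      obtain ⟨u, hu⟩ := h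
      rw [← List.append_assoc] at hu
      exact ⟨u, List.append_cancel_right hu⟩
    cases t with
    | nil => exact List.suffix_rfl
    | cons c t =>
      obtain rfl : c = Γ'.bra := by simpa using hx
      exact absurd (ht.subset (List.mem_cons_self)) hA

theorem bra_notMem_flat {ts : List (List Γ')} (h : ∀ t ∈ ts, Γ'.bra ∉ t) :
    Γ'.bra ∉ flat Γ'.comma ts := by
  intro h'
  obtain ⟨t, ht, ht'⟩ := List.mem_flatMap.1 h'
  simp only [List.mem_append, List.mem_singleton, reduceCtorEq, or_false] at ht'
  exact h t ht ht'

theorem suffix_flatMap_encTrans {m : ℕ} {x r : List Γ'} (ts : List (Transition a b m))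
    (h : x <:+ ts.flatMap encTrans ++ r) (hx : x.head? = some Γ'.bra) :
    (∃ t ∈ ts, ∃ r', x = encTrans t ++ r' ∧ r <:+ r') ∨ x <:+ r := by
  induction ts with
  | nil => exact Or.inr (by simpa using h)
  | cons t ts ih =>
    rw [List.flatMap_cons, encTrans_eq, List.append_assoc, List.cons_append,
      List.suffix_cons_iff] at h
    rcases h with rfl | h
    · exact Or.inl ⟨t, by simp, ts.flatMap encTrans ++ r, by simp [encTrans_eq],
        List.suffix_append _ _⟩
    · have hb : Γ'.bra ∉ flat Γ'.comma (toks t) ++ [Γ'.ket] := by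
        have := bra_notMem_flat (ts := toks t) fun y hy hb => (mem_toks hy hb).2 rfl
        simpa using this
      rcases ih (suffix_of_bra h hx hb) with ⟨t', ht', h'⟩ | h'
      · exact Or.inl ⟨t', by simp [ht'], h'⟩
      · exact Or.inr h'

/-- In a machine, a `bra` begins either the machine itself or one of its transitions. -/
theorem FSMDesc.suffix_encode (D : FSMDesc a b) {x r : List Γ'} (h : x <:+ D.encode ++ r)
    (hx : x.head? = some Γ'.bra) : x = D.encode ++ r ∨
      (∃ t ∈ D.trans, ∃ r', x = encTrans t ++ r' ∧ r <:+ r' ∧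
        x.length < (D.encode ++ r).length) ∨ x <:+ r := by
  rw [FSMDesc.encode_eq, List.cons_append, List.suffix_cons_iff] at h
  rcases h with h | h
  · exact Or.inl (by rw [h, FSMDesc.encode_eq, List.cons_append])
  · have hlen : x.length < (D.encode ++ r).length := by
      have := h.length_le
      rw [FSMDesc.encode_eq, List.cons_append, List.length_cons]
      omega
    rw [List.append_assoc, List.append_assoc] at h
    have h₁ : x <:+ D.trans.flatMap encTrans ++ ([Γ'.ket] ++ r) := by
      refine suffix_of_bra h hx (bra_notMem_flat ?_)
      intro t ht hb
      simp only [List.mem_cons, List.not_mem_nil, or_false] at ht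
      rcases ht with rfl | rfl <;>
      · obtain ⟨d, hd⟩ := mem_tokN hb
        cases hd
    rcases suffix_flatMap_encTrans D.trans h₁ hx with ⟨t, ht, r', e, hr⟩ | h'
    · exact Or.inr (Or.inl ⟨t, ht, r', e, (List.suffix_append _ _).trans hr, hlen⟩)
    · exact Or.inr (Or.inr (suffix_of_bra h' hx (by simp)))

end Records

section Positions

variable {K B : ℕ}

/-- The two machines of an instance: the implementation `N` for `true`, the specification `M` for
`false`. -/
def Instance.desc (q : Instance K B) : Bool → FSMDesc q.a q.b
  | true => q.N
  | false => q.M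

/-- The part of the encoding after a machine. -/
def Instance.rest (q : Instance K B) : Bool → List Γ'
  | true => q.M.encode
  | false => []

/-- The part of the encoding before the machines. -/
def Instance.preamble (q : Instance K B) : List Γ' :=
  encNat q.k ++ encNat q.n ++
    (List.finRange q.n).flatMap (fun p => encNat (q.a p) ++ encNat (q.b p))

theorem Instance.encode_eq (q : Instance K B) :
    q.encode = q.preamble ++ (q.N.encode ++ q.M.encode) := by
  simp [Instance.encode, Instance.preamble]

theorem Instance.bra_notMem_preamble (q : Instance K B) : Γ'.bra ∉ q.preamble := by
  have hN : ∀ m, Γ'.bra ∉ encNat m := by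
    intro m h
    simp only [encNat_eq, List.mem_append, List.mem_singleton, reduceCtorEq, or_false] at h
    obtain ⟨d, hd⟩ := mem_tokN h
    cases hd
  simp only [Instance.preamble, List.mem_append, List.mem_flatMap, hN]
  simp

/-- The part of the encoding that begins with the machine `b`. -/
def Instance.head (q : Instance K B) (b : Bool) : List Γ' := (q.desc b).encode ++ q.rest b

theorem Instance.head_suffix (q : Instance K B) (b : Bool) : q.head b <:+ q.encode := by
  rw [q.encode_eq]
  cases b with
  | true => exact List.suffix_append _ _
  | false =>
    rw [← List.append_assoc]
    exact ⟨q.preamble ++ q.N.encode, by simp [Instance.head, Instance.desc, Instance.rest]⟩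

/-- The transition `t` of the machine `b` is found at the suffix `s` of the encoding. A transition
of `N` is followed by the whole encoding of `M`, so the length of `s` tells the machines apart. -/
structure Instance.IsAt (q : Instance K B) (b : Bool) (s : List Γ')
    (t : Transition q.a q.b (q.desc b).numStates) : Prop where
  suffix : s <:+ q.encode
  mem : t ∈ (q.desc b).trans
  eq : ∃ r, s = encTrans t ++ r
  side : q.M.encode.length < s.length ↔ b = true

theorem Instance.exists_isAt (q : Instance K B) {b : Bool}
    {t : Transition q.a q.b (q.desc b).numStates} (ht : t ∈ (q.desc b).trans) :
    ∃ s, q.IsAt b s t := by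
  obtain ⟨l, l', e⟩ := List.append_of_mem ht
  have hs : encTrans t ++ (l'.flatMap encTrans ++ (Γ'.ket :: q.rest b)) <:+
      (flat Γ'.comma [tokN (q.desc b).numStates, tokN (q.desc b).init] ++
        ((q.desc b).trans.flatMap encTrans ++ [Γ'.ket])) ++ q.rest b :=
    ⟨flat Γ'.comma [tokN (q.desc b).numStates, tokN (q.desc b).init] ++ l.flatMap encTrans,
      by simp [e]⟩
  have hh : q.head b = Γ'.bra :: ((flat Γ'.comma [tokN (q.desc b).numStates,
      tokN (q.desc b).init] ++ ((q.desc b).trans.flatMap encTrans ++ [Γ'.ket])) ++ q.rest b) := by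
    rw [Instance.head, FSMDesc.encode_eq]
    rfl
  refine ⟨_, (hs.trans ?_).trans (q.head_suffix b), ht, ⟨_, rfl⟩, ?_⟩
  · rw [hh]
    exact List.suffix_cons _ _
  · cases b with
    | true =>
      simp only [Instance.rest, List.length_append, List.length_cons, iff_true]
      omega
    | false =>
      have hl : (q.head false).length = q.M.encode.length := by
        simp [Instance.head, Instance.rest, Instance.desc]
      have := hs.length_le
      rw [hh, List.length_cons] at hl
      simp only [Bool.false_eq_true, iff_false]
      omega

/-- In the encoding of an instance, a `bra` begins a machine or a transition of a machine. -/
theorem Instance.suffix_cases (q : Instance K B) {x : List Γ'} (h : x <:+ q.encode)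
    (hx : x.head? = some Γ'.bra) : ∃ b, x = q.head b ∨ ∃ t, q.IsAt b x t := by
  have h₁ := h
  rw [q.encode_eq] at h₁
  rcases q.N.suffix_encode (suffix_of_bra h₁ hx q.bra_notMem_preamble) hx with
    h' | ⟨t, ht, r, e, hr, -⟩ | h'
  · exact ⟨true, Or.inl h'⟩
  · refine ⟨true, Or.inr ⟨t, h, ht, ⟨r, e⟩, ?_⟩⟩
    have := hr.length_le
    simp only [e, encTrans_eq, List.length_append, List.length_cons, iff_true]
    omega
  · rw [← List.append_nil q.M.encode] at h'
    rcases q.M.suffix_encode h' hx with h'' | ⟨t, ht, r, e, -, hl⟩ | h''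
    · exact ⟨false, Or.inl h''⟩
    · refine ⟨false, Or.inr ⟨t, h, ht, ⟨r, e⟩, ?_⟩⟩
      rw [List.append_nil] at hl
      simp only [Bool.false_eq_true, iff_false]
      omega
    · rw [List.suffix_nil.1 h''] at hx
      cases hx

theorem Instance.length_head (q : Instance K B) (b : Bool) :
    q.M.encode.length < (q.head b).length ↔ b = true := by
  cases b with
  | true =>
    simp only [Instance.head, Instance.desc, Instance.rest, List.length_append, iff_true]
    rw [q.N.encode_eq, List.length_cons]
    omega
  | false => simp [Instance.head, Instance.desc, Instance.rest]

end Positions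

end MultiPort

/-! ### Bounded conformance as a formula about the encoding -/

namespace MultiPort

open StackProgram Computability

/-- A machine begins at `i`: a `bra` that is followed by exactly two tokens before the next
bracket. In a transition, the port number is a third token. -/
def isHead (i : ℕ) : Fm Γ' :=
  .and (.sym Γ'.bra i)
    (.or (.fieldSym Γ'.comma Γ'.bra 2 i) (.fieldSym Γ'.comma Γ'.ket 2 i))

/-- Some machine begins after `i`; that is, `i` lies before the specification. -/
def beforeHead (i : ℕ) : Fm Γ' := .ex (.and (isHead 0) (.longer (i + 1) 0))

/-- The machine or transition at `i` belongs to the implementation (for `true`) or to the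
specification (for `false`). -/
def side (b : Bool) (i : ℕ) : Fm Γ' := if b then beforeHead i else .not (beforeHead i)

/-- A transition of the machine `b` begins at `i`. -/
def isTrans (b : Bool) (i : ℕ) : Fm Γ' :=
  .and (.sym Γ'.bra i) (.and (.not (isHead i)) (side b i))

/-- The transition at `i` starts in the initial state of the machine `b`. -/
def starts (b : Bool) (i : ℕ) : Fm Γ' :=
  .ex (.and (.and (isHead 0) (side b 0)) (.fieldEq Γ'.comma 0 (i + 1) 1 0))

/-- The variables `l` are a path of the machine `b` whose first transition satisfies `src`. -/
def isPath (b : Bool) : (ℕ → Fm Γ') → List ℕ → Fm Γ'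
  | _, [] => .top
  | src, i :: l =>
    .and (.and (isTrans b i) (src i)) (isPath b (fun j => .fieldEq Γ'.comma 1 i 0 j) l)

/-- There is an observation at the port `p` in the given slot. -/
def present (p : ℕ) : Bool × ℕ → Fm Γ'
  | (true, i) => .fieldIs Γ'.comma (tokN p) 2 i
  | (false, i) => .not (.fieldIs Γ'.comma [Γ'.blank] (4 + p) i)

/-- The observations at the port `p` in the given slots are the same. -/
def same (p : ℕ) : Bool × ℕ → Bool × ℕ → Fm Γ'
  | (true, i), (true, j) => .fieldEq Γ'.comma 3 i 3 j
  | (false, i), (false, j) => .fieldEq Γ'.comma (4 + p) i (4 + p) j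
  | _, _ => .not .top

/-- The observations at the port `p` in two lists of slots are the same sequence. -/
def sameSeq (p : ℕ) : List (Bool × ℕ) → List (Bool × ℕ) → Fm Γ'
  | [], [] => .top
  | [], e :: l => .and (.not (present p e)) (sameSeq p [] l)
  | e :: l, [] => .and (.not (present p e)) (sameSeq p l [])
  | e :: l, e' :: l' =>
    .or (.and (.not (present p e)) (sameSeq p l (e' :: l')))
      (.or (.and (.and (present p e) (.not (present p e'))) (sameSeq p (e :: l) l'))
        (.and (.and (present p e) (present p e')) (.and (same p e e') (sameSeq p l l'))))
  termination_by l l' => l.length + l'.length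

/-- Every path of length `m` of the implementation has an indistinguishable path of length `m` of
the specification, where `n` is the number of ports. Under both blocks of quantifiers, the
variables with the indices below `m` are the transitions of the specification, and the next `m`
variables are those of the implementation. -/
def conformsAt (n m : ℕ) : Fm Γ' :=
  .alls m (.imp (isPath true (starts true) (List.range m))
    (.exs m (.and (isPath false (starts false) (List.range m))
      (.conj ((List.range n).map fun p =>
        sameSeq p (slots ((List.range m).map (· + m))) (slots (List.range m)))))))

/-- The word encodes an instance with the length bound `k` and `n` ports. -/
def parameters (k n : ℕ) : Fm Γ' :=
  .and (.tokIs Γ'.comma (tokN k) 0)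
    (.ex (.and (.after Γ'.comma 1 0) (.tokIs Γ'.comma (tokN n) 0)))

/-- Bounded conformance, for all `k ≤ K` and `n ≤ B`. -/
def conforms (K B : ℕ) : Fm Γ' :=
  .disj ((List.range (K + 1)).map fun k => .disj ((List.range (B + 1)).map fun n =>
    .and (parameters k n) (.conj ((List.range (k + 1)).map (conformsAt n)))))

section Correctness

variable {K B : ℕ} {q : Instance K B} {ν : ℕ → List Γ'}

theorem Instance.isRecord_head (b : Bool) : IsRecord Γ'.comma (q.head b)
    [tokN (q.desc b).numStates, tokN (q.desc b).init]
    ((q.desc b).trans.flatMap encTrans ++ Γ'.ket :: q.rest b) := FSMDesc.isRecord_encode _ _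

theorem Instance.head?_head (b : Bool) : (q.head b).head? = some Γ'.bra := by
  rw [Instance.head, FSMDesc.encode_eq]
  rfl

theorem Instance.IsAt.isRecord {b : Bool} {s : List Γ'}
    {t : Transition q.a q.b (q.desc b).numStates} (h : q.IsAt b s t) :
    ∃ r, IsRecord Γ'.comma s (toks t) r := by
  obtain ⟨r, rfl⟩ := h.eq
  exact ⟨_, isRecord_encTrans t r⟩

theorem Instance.IsAt.head? {b : Bool} {s : List Γ'}
    {t : Transition q.a q.b (q.desc b).numStates} (h : q.IsAt b s t) :
    s.head? = some Γ'.bra := by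
  obtain ⟨r, rfl⟩ := h.eq
  rw [encTrans_eq]
  rfl

theorem not_holds_isHead {b : Bool} {i : ℕ} {t : Transition q.a q.b (q.desc b).numStates}
    (h : q.IsAt b (ν i) t) : ¬ (isHead i).Holds q.encode ν := by
  rw [isHead, Fm.holds_and, Fm.holds_or]
  rintro ⟨-, h₂⟩
  obtain ⟨r, hr⟩ := h.isRecord
  have hl : 2 ≤ (toks t).length := by simp [toks]
  rw [Fm.holds_fieldSym h.suffix hr hl, Fm.holds_fieldSym h.suffix hr hl,
    flat_drop_eq (t := tokN t.2.2.1.1) (by simp [toks])] at h₂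
  -- The field begins with a bit or, for port `0`, whose token is empty, with the separator.
  cases e : tokN t.2.2.1.1 with
  | nil => simp [e] at h₂
  | cons c l =>
    obtain ⟨d, rfl⟩ := mem_tokN (m := t.2.2.1.1) (c := c) (by simp [e])
    simp [e] at h₂

theorem holds_isHead {i : ℕ} (hi : ν i <:+ q.encode) :
    (isHead i).Holds q.encode ν ↔ ∃ b, ν i = q.head b := by
  constructor
  · intro h
    obtain ⟨b, h' | ⟨t, h'⟩⟩ := q.suffix_cases hi (Fm.holds_sym.1 h.1)
    · exact ⟨b, h'⟩
    · exact absurd h (not_holds_isHead h')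
  · rintro ⟨b, h⟩
    have hr : IsRecord Γ'.comma (ν i) _ _ := h ▸ q.isRecord_head b
    rw [isHead, Fm.holds_and, Fm.holds_sym, Fm.holds_or]
    refine ⟨by rw [h, q.head?_head], ?_⟩
    rw [Fm.holds_fieldSym hi hr (by simp), Fm.holds_fieldSym hi hr (by simp)]
    cases (q.desc b).trans with
    | nil => simp [flat]
    | cons t l => simp [flat, encTrans_eq]

theorem holds_beforeHead {i : ℕ} :
    (beforeHead i).Holds q.encode ν ↔ q.M.encode.length < (ν i).length := by
  rw [beforeHead, Fm.holds_ex]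
  constructor
  · rintro ⟨s, hs, h₁, h₂⟩
    obtain ⟨b, hb⟩ := (holds_isHead (ν := vcons s ν) (i := 0) hs).1 h₁
    have h₂ : s.length < (ν i).length := Fm.holds_longer.1 h₂
    have hb : s = q.head b := hb
    have hle : q.M.encode.length ≤ (q.head b).length := by
      cases b with
      | true => exact ((q.length_head true).2 rfl).le
      | false => simp [Instance.head, Instance.desc]
    rw [hb] at h₂
    omega
  · intro h
    refine ⟨q.head false, q.head_suffix false,
      (holds_isHead (ν := vcons _ ν) (i := 0) (q.head_suffix false)).2 ⟨false, rfl⟩,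
      Fm.holds_longer.2 ?_⟩
    simpa [vcons, Instance.head, Instance.desc, Instance.rest] using h

theorem holds_side {b : Bool} {i : ℕ} :
    (side b i).Holds q.encode ν ↔ (q.M.encode.length < (ν i).length ↔ b = true) := by
  cases b with
  | true => simp [side, holds_beforeHead]
  | false => simp [side, Fm.holds_not, holds_beforeHead]

theorem holds_isTrans {b : Bool} {i : ℕ} (hi : ν i <:+ q.encode) :
    (isTrans b i).Holds q.encode ν ↔ ∃ t, q.IsAt b (ν i) t := by
  rw [isTrans, Fm.holds_and, Fm.holds_and, Fm.holds_not, holds_side, Fm.holds_sym]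
  constructor
  · rintro ⟨h₁, h₂, h₃⟩
    obtain ⟨b', h | ⟨t, h⟩⟩ := q.suffix_cases hi h₁
    · exact absurd ((holds_isHead hi).2 ⟨b', h⟩) h₂
    · obtain rfl : b' = b := Bool.eq_iff_iff.2 (h.side.symm.trans h₃)
      exact ⟨t, h⟩
  · rintro ⟨t, h⟩
    exact ⟨h.head?, not_holds_isHead h, h.side⟩

theorem holds_starts {b : Bool} {i : ℕ} {t : Transition q.a q.b (q.desc b).numStates}
    (h : q.IsAt b (ν i) t) :
    (starts b i).Holds q.encode ν ↔ t.1 = (q.desc b).init := by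
  obtain ⟨r, hr⟩ := h.isRecord
  have key : ∀ s, s <:+ q.encode → s = q.head b →
      ((Fm.fieldEq Γ'.comma 0 (i + 1) 1 0).Holds q.encode (vcons s ν) ↔
        t.1 = (q.desc b).init) := by
    rintro s hs rfl
    refine (Fm.holds_fieldEq (ν := vcons _ ν) (f := 0) (i := i + 1) (g := 1) (j := 0)
      (t := tokN t.1) (t' := tokN (q.desc b).init) h.suffix hs hr (q.isRecord_head b)
      (by simp [toks]) (by simp)).trans ?_
    exact ⟨fun e => Fin.ext (tokN_injective e), fun e => by rw [e]⟩
  rw [starts, Fm.holds_ex]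
  constructor
  · rintro ⟨s, hs, h₁, h₂⟩
    obtain ⟨h₁, h₃⟩ := Fm.holds_and.1 h₁
    obtain ⟨b', hb'⟩ := (holds_isHead (ν := vcons s ν) (i := 0) hs).1 h₁
    have h₃ := (holds_side (ν := vcons s ν) (i := 0)).1 h₃
    rw [hb', q.length_head] at h₃
    obtain rfl : b' = b := Bool.eq_iff_iff.2 h₃
    exact (key s hs hb').1 h₂
  · intro e
    have hs := q.head_suffix b
    exact ⟨q.head b, hs, ⟨(holds_isHead (ν := vcons _ ν) (i := 0) hs).2 ⟨b, rfl⟩,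
      (holds_side (ν := vcons _ ν) (i := 0)).2 (q.length_head b)⟩, (key _ hs rfl).2 e⟩

theorem holds_isPath {b : Bool} {l : List ℕ} (hl : ∀ i ∈ l, ν i <:+ q.encode) :
    ∀ (src : ℕ → Fm Γ') (s : Fin (q.desc b).numStates),
      (∀ i t, q.IsAt b (ν i) t → ((src i).Holds q.encode ν ↔ t.1 = s)) →
      ((isPath b src l).Holds q.encode ν ↔
        ∃ ts, List.Forall₂ (fun i t => q.IsAt b (ν i) t) l ts ∧ Linked s ts) := by
  induction l with
  | nil =>
    intro src s _
    simp [isPath, Fm.holds_top, Linked]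
  | cons i l ih =>
    intro src s hsrc
    have hi := hl i (by simp)
    have ih' := ih fun j hj => hl j (by simp [hj])
    have hnext : ∀ t, q.IsAt b (ν i) t → ∀ j t', q.IsAt b (ν j) t' →
        ((Fm.fieldEq Γ'.comma 1 i 0 j).Holds q.encode ν ↔ t'.1 = t.2.1) := by
      intro t ht j t' ht'
      obtain ⟨r, hr⟩ := ht.isRecord
      obtain ⟨r', hr'⟩ := ht'.isRecord
      rw [Fm.holds_fieldEq ht.suffix ht'.suffix hr hr' (t := tokN t.2.1) (t' := tokN t'.1)
        (by simp [toks]) (by simp [toks])]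
      exact ⟨fun e => Fin.ext (tokN_injective e.symm), fun e => by rw [e]⟩
    rw [isPath, Fm.holds_and, Fm.holds_and, holds_isTrans hi]
    constructor
    · rintro ⟨⟨⟨t, ht⟩, h₁⟩, h₂⟩
      obtain ⟨ts, h₃, h₄⟩ := (ih' _ t.2.1 (hnext t ht)).1 h₂
      exact ⟨t :: ts, .cons ht h₃, (hsrc i t ht).1 h₁, h₄⟩
    · rintro ⟨ts, h₁, h₂⟩
      obtain ⟨t, ts, ht, h₃, rfl⟩ := List.forall₂_cons_left_iff.1 h₁
      exact ⟨⟨⟨t, ht⟩, (hsrc i t ht).2 h₂.1⟩, (ih' _ t.2.1 (hnext t ht)).2 ⟨ts, h₃, h₂.2⟩⟩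

/-- The slots `e` and `e'` are of the same kind, and the variable in `e` is a position of the
transition in `e'`. -/
def SlotAt (q : Instance K B) (ν : ℕ → List Γ') (b : Bool) (e : Bool × ℕ)
    (e' : Bool × Transition q.a q.b (q.desc b).numStates) : Prop :=
  e.1 = e'.1 ∧ q.IsAt b (ν e.2) e'.2

theorem forall₂_slots {b : Bool} {l : List ℕ}
    {ts : List (Transition q.a q.b (q.desc b).numStates)}
    (h : List.Forall₂ (fun i t => q.IsAt b (ν i) t) l ts) :
    List.Forall₂ (SlotAt q ν b) (slots l) (slots ts) := by
  induction h with
  | nil => exact .nil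
  | cons h _ ih => exact .cons ⟨rfl, h⟩ (.cons ⟨rfl, h⟩ ih)

theorem holds_present {b : Bool} (p : Fin q.n) {e : Bool × ℕ}
    {e' : Bool × Transition q.a q.b (q.desc b).numStates} (h : SlotAt q ν b e e') :
    (present p e).Holds q.encode ν ↔ (observation p e').isSome = true := by
  obtain ⟨k, i⟩ := e
  obtain ⟨k', t⟩ := e'
  obtain ⟨h₁, h⟩ := h
  obtain rfl : k = k' := h₁
  obtain ⟨r, hr⟩ := h.isRecord
  cases k with
  | true =>
    rw [present, Fm.holds_fieldIs h.suffix hr (t := tokN t.2.2.1.1) (by simp [toks])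
      (comma_notMem_tokN _), tokN_injective.eq_iff, ← Fin.ext_iff, observation]
    split_ifs with hp <;> simp [hp]
  | false =>
    rw [present, Fm.holds_not, Fm.holds_fieldIs h.suffix hr (toks_output t p) (by simp),
      tokO_eq_blank_iff, observation]
    cases t.2.2.2 p <;> simp

theorem holds_same {b b' : Bool} (p : Fin q.n) {e₁ e₂ : Bool × ℕ}
    {e₁' : Bool × Transition q.a q.b (q.desc b).numStates}
    {e₂' : Bool × Transition q.a q.b (q.desc b').numStates}
    (h₁ : SlotAt q ν b e₁ e₁') (h₂ : SlotAt q ν b' e₂ e₂')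
    (hs₁ : (observation p e₁').isSome = true) (hs₂ : (observation p e₂').isSome = true) :
    (same p e₁ e₂).Holds q.encode ν ↔ observation p e₁' = observation p e₂' := by
  obtain ⟨k₁, i₁⟩ := e₁
  obtain ⟨k₁', t₁⟩ := e₁'
  obtain ⟨k₂, i₂⟩ := e₂
  obtain ⟨k₂', t₂⟩ := e₂'
  obtain ⟨hk₁, h₁⟩ := h₁
  obtain ⟨hk₂, h₂⟩ := h₂
  obtain rfl : k₁ = k₁' := hk₁
  obtain rfl : k₂ = k₂' := hk₂
  obtain ⟨r₁, hr₁⟩ := h₁.isRecord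
  obtain ⟨r₂, hr₂⟩ := h₂.isRecord
  cases k₁ with
  | true =>
    cases k₂ with
    | true =>
      rw [same, Fm.holds_fieldEq h₁.suffix h₂.suffix hr₁ hr₂ (t := tokN t₁.2.2.1.2)
        (t' := tokN t₂.2.2.1.2) (by simp [toks]) (by simp [toks]), tokN_injective.eq_iff]
      obtain ⟨s₁, s₁', ⟨p₁, x₁⟩, y₁⟩ := t₁
      obtain ⟨s₂, s₂', ⟨p₂, x₂⟩, y₂⟩ := t₂
      have e₁ : p₁ = p := by
        by_contra hp
        simp [observation, hp] at hs₁
      have e₂ : p₂ = p := by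
        by_contra hp
        simp [observation, hp] at hs₂
      subst e₁
      subst e₂
      simp [observation, Fin.ext_iff]
    | false =>
      rw [same, Fm.holds_not, Fm.holds_top]
      · simp only [not_true_eq_false, false_iff]
        simp only [observation]
        split_ifs <;> cases t₂.2.2.2 p <;> simp_all [observation]
      all_goals simp
  | false =>
    cases k₂ with
    | true =>
      rw [same, Fm.holds_not, Fm.holds_top]
      · simp only [not_true_eq_false, false_iff]
        simp only [observation]
        split_ifs <;> cases t₁.2.2.2 p <;> simp_all [observation]
      all_goals simp
    | false =>
      rw [same, Fm.holds_fieldEq h₁.suffix h₂.suffix hr₁ hr₂ (toks_output t₁ p)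
        (toks_output t₂ p), tokO_injective.eq_iff, observation, observation,
        (Option.map_injective Sum.inr_injective).eq_iff]

theorem holds_sameSeq {b b' : Bool} (p : Fin q.n) (l₁ l₂ : List (Bool × ℕ)) :
    ∀ (L₁ : List (Bool × Transition q.a q.b (q.desc b).numStates))
      (L₂ : List (Bool × Transition q.a q.b (q.desc b').numStates)),
      List.Forall₂ (SlotAt q ν b) l₁ L₁ → List.Forall₂ (SlotAt q ν b') l₂ L₂ →
      ((sameSeq p l₁ l₂).Holds q.encode ν ↔
        L₁.filterMap (observation p) = L₂.filterMap (observation p)) := by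
  induction l₁, l₂ using sameSeq.induct with
  | case1 =>
    rintro _ _ ⟨⟩ ⟨⟩
    simp [sameSeq, Fm.holds_top]
  | case2 e l ih =>
    rintro _ _ ⟨⟩ (_ | @⟨_, e', _, L, he, hL⟩)
    rw [sameSeq, Fm.holds_and, Fm.holds_not, holds_present p he, ih _ _ .nil hL]
    cases ho : observation p e' <;> simp [ho]
  | case3 e l ih =>
    rintro _ _ (_ | @⟨_, e', _, L, he, hL⟩) ⟨⟩
    rw [sameSeq, Fm.holds_and, Fm.holds_not, holds_present p he, ih _ _ hL .nil]
    cases ho : observation p e' <;> simp [ho]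
  | case4 e l e' l' ih₁ ih₂ ih₃ =>
    rintro _ _ (_ | @⟨_, d, _, L, he, hL⟩) (_ | @⟨_, d', _, L', he', hL'⟩)
    rw [sameSeq, Fm.holds_or, Fm.holds_or, Fm.holds_and, Fm.holds_and, Fm.holds_and,
      Fm.holds_and, Fm.holds_and, Fm.holds_not, Fm.holds_not, holds_present p he,
      holds_present p he', ih₁ _ _ hL (.cons he' hL'), ih₂ _ _ (.cons he hL) hL',
      Fm.holds_and, ih₃ _ _ hL hL']
    cases ho : observation p d with
    | none => simp [List.filterMap_cons, ho]
    | some z =>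
      cases ho' : observation p d' with
      | none => simp [ho, ho']
      | some z' =>
        rw [holds_same p he he' (by simp [ho]) (by simp [ho']), ho, ho']
        simp [ho, ho']

/-- Every sequence of transitions of a machine is given by a sequence of positions. -/
theorem exists_positions {b : Bool} (ts : List (Transition q.a q.b (q.desc b).numStates))
    (h : ∀ t ∈ ts, t ∈ (q.desc b).trans) : ∃ l, List.Forall₂ (q.IsAt b) l ts := by
  induction ts with
  | nil => exact ⟨[], .nil⟩
  | cons t ts ih =>
    obtain ⟨s, hs⟩ := q.exists_isAt (h t (by simp))
    obtain ⟨l, hl⟩ := ih fun t' ht' => h t' (by simp [ht'])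
    exact ⟨s :: l, .cons hs hl⟩

theorem forall_mem_of_forall₂ {b : Bool} {l : List (List Γ')}
    {ts : List (Transition q.a q.b (q.desc b).numStates)} (h : List.Forall₂ (q.IsAt b) l ts) :
    (∀ s ∈ l, s <:+ q.encode) ∧ ∀ t ∈ ts, t ∈ (q.desc b).trans := by
  induction h with
  | nil => simp
  | cons h _ ih => exact ⟨List.forall_mem_cons.2 ⟨h.suffix, ih.1⟩,
      List.forall_mem_cons.2 ⟨h.mem, ih.2⟩⟩

/-- The formula for paths, when the variables below `m` have been bound as a block. -/
theorem holds_isPath_range {b : Bool} {l : List (List Γ')} (hl : ∀ s ∈ l, s <:+ q.encode) :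
    (isPath b (starts b) (List.range l.length)).Holds q.encode (vapp l ν) ↔
      ∃ ts, List.Forall₂ (q.IsAt b) l ts ∧ Linked (q.desc b).init ts := by
  have hl' : ∀ i ∈ List.range l.length, vapp l ν i <:+ q.encode := by
    intro i hi
    have hmem := List.mem_map_of_mem (f := vapp l ν) hi
    rw [map_range_vapp] at hmem
    exact hl _ hmem
  rw [holds_isPath hl' _ _ fun i t h => holds_starts h]
  have key : ∀ ts, List.Forall₂ (fun i t => q.IsAt b (vapp l ν i) t) (List.range l.length) ts ↔
      List.Forall₂ (q.IsAt b) l ts := by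
    intro ts
    rw [← List.forall₂_map_left_iff, map_range_vapp]
  simp only [key]

theorem holds_conformsAt (m : ℕ) : (conformsAt q.n m).Holds q.encode ν ↔
    ∀ ts : List (Transition q.a q.b (q.desc true).numStates), ts.length = m →
      (∀ t ∈ ts, t ∈ (q.desc true).trans) → Linked (q.desc true).init ts →
      ∃ ts' : List (Transition q.a q.b (q.desc false).numStates), ts'.length = m ∧
        (∀ t ∈ ts', t ∈ (q.desc false).trans) ∧ Linked (q.desc false).init ts' ∧
        ∀ p, proj p (label ts) = proj p (label ts') := by
  have hmatch : ∀ {l l' : List (List Γ')} {ts : List (Transition q.a q.b (q.desc true).numStates)}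
      {ts' : List (Transition q.a q.b (q.desc false).numStates)}, l.length = m → l'.length = m →
      List.Forall₂ (q.IsAt true) l ts → List.Forall₂ (q.IsAt false) l' ts' →
      ((Fm.conj ((List.range q.n).map fun p =>
        sameSeq p (slots ((List.range m).map (· + m))) (slots (List.range m)))).Holds q.encode
          (vapp l' (vapp l ν)) ↔ ∀ p, proj p (label ts) = proj p (label ts')) := by
    intro l l' ts ts' hlen hlen' h h'
    have h₁ : List.Forall₂ (fun i t => q.IsAt true (vapp l' (vapp l ν) i) t)
        ((List.range m).map (· + m)) ts := by
      rw [List.forall₂_map_left_iff]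
      rw [← map_range_vapp l ν, hlen, List.forall₂_map_left_iff] at h
      refine h.imp fun i t hi => ?_
      rwa [← hlen', vapp_add]
    have h₂ : List.Forall₂ (fun i t => q.IsAt false (vapp l' (vapp l ν) i) t)
        (List.range m) ts' := by
      rwa [← map_range_vapp l' (vapp l ν), hlen', List.forall₂_map_left_iff] at h'
    rw [Fm.holds_conj]
    simp only [List.mem_map, List.mem_range, forall_exists_index, and_imp,
      forall_apply_eq_imp_iff₂]
    constructor
    · intro hp p
      rw [proj_label, proj_label]
      exact (holds_sameSeq p _ _ _ _ (forall₂_slots h₁) (forall₂_slots h₂)).1 (hp p p.2)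
    · intro hp p hpn
      have := hp ⟨p, hpn⟩
      rw [proj_label, proj_label] at this
      exact (holds_sameSeq ⟨p, hpn⟩ _ _ _ _ (forall₂_slots h₁) (forall₂_slots h₂)).2 this
  rw [conformsAt, Fm.holds_alls]
  constructor
  · intro h ts hlen hts hlink
    obtain ⟨l, hl⟩ := exists_positions (q := q) (b := true) ts hts
    have hm : l.length = m := hl.length_eq.trans hlen
    have hsuf := (forall_mem_of_forall₂ hl).1
    have h₁ := h l hm hsuf
    rw [Fm.holds_imp, Fm.holds_exs] at h₁
    obtain ⟨l', hm', hsuf', h₂, h₃⟩ := h₁ (by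
      rw [← hm]
      exact (holds_isPath_range hsuf).2 ⟨ts, hl, hlink⟩)
    rw [← hm'] at h₂
    obtain ⟨ts', hl', hlink'⟩ := (holds_isPath_range hsuf').1 h₂
    exact ⟨ts', hl'.length_eq.symm.trans hm', (forall_mem_of_forall₂ hl').2, hlink',
      (hmatch hm hm' hl hl').1 h₃⟩
  · intro h l hm hsuf
    rw [Fm.holds_imp, Fm.holds_exs]
    intro h₁
    rw [← hm] at h₁
    obtain ⟨ts, hl, hlink⟩ := (holds_isPath_range hsuf).1 h₁
    obtain ⟨ts', hlen', hts', hlink', hp⟩ := h ts (hl.length_eq.symm.trans hm)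
      (forall_mem_of_forall₂ hl).2 hlink
    obtain ⟨l', hl'⟩ := exists_positions (q := q) (b := false) ts' hts'
    have hm' : l'.length = m := hl'.length_eq.trans hlen'
    have hsuf' := (forall_mem_of_forall₂ hl').1
    refine ⟨l', hm', hsuf', ?_, (hmatch hm hm' hl hl').2 hp⟩
    have := (holds_isPath_range (ν := vapp l ν) hsuf').2 ⟨ts', hl', hlink'⟩
    rwa [hm'] at this

theorem holds_parameters (k n : ℕ) :
    (parameters k n).Holds q.encode (fun _ => q.encode) ↔ k = q.k ∧ n = q.n := by
  obtain ⟨r, hr⟩ : ∃ r, q.encode = tokN q.k ++ Γ'.comma :: (tokN q.n ++ Γ'.comma :: r) :=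
    ⟨(List.finRange q.n).flatMap (fun p => encNat (q.a p) ++ encNat (q.b p)) ++
      (q.N.encode ++ q.M.encode), by
        simp [Instance.encode_eq, Instance.preamble, encNat_eq]⟩
  have hfree := comma_notMem_tokN
  have key : ∀ (m m' : ℕ) (r' : List Γ'),
      tokN m ++ [Γ'.comma] <+: tokN m' ++ Γ'.comma :: r' ↔ m = m' := by
    intro m m' r'
    constructor
    · rintro ⟨u, hu⟩
      rw [List.append_assoc, List.singleton_append] at hu
      exact tokN_injective (eq_of_append_cons_eq (hfree m) (hfree m') hu).1
    · rintro rfl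
      exact ⟨r', by simp⟩
  have hsuf : tokN q.n ++ Γ'.comma :: r <:+ q.encode :=
    ⟨tokN q.k ++ [Γ'.comma], by rw [hr]; simp⟩
  rw [parameters, Fm.holds_and, Fm.holds_tokIs (ν := fun _ => q.encode) (i := 0) List.suffix_rfl,
    Fm.holds_ex]
  have h₁ : tokN k ++ [Γ'.comma] <+: q.encode ↔ k = q.k := by rw [hr, key]
  refine and_congr h₁ ?_
  constructor
  · rintro ⟨s, hs, h₂, h₃⟩
    obtain ⟨t, ht, e⟩ := (Fm.holds_after (w := q.encode) (ν := vcons s fun _ => q.encode) (i := 1)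
      (j := 0) List.suffix_rfl hs).1 h₂
    have h₃ := (Fm.holds_tokIs (ν := vcons s fun _ => q.encode) (i := 0) hs).1 h₃
    have e : q.encode = t ++ Γ'.comma :: s := e
    rw [hr] at e
    obtain rfl := (eq_of_append_cons_eq (hfree _) ht e).2
    exact (key _ _ _).1 h₃
  · rintro rfl
    exact ⟨_, hsuf, (Fm.holds_after (w := q.encode) (ν := vcons _ fun _ => q.encode) (i := 1)
      (j := 0) List.suffix_rfl hsuf).2 ⟨tokN q.k, hfree _, hr⟩,
      (Fm.holds_tokIs (ν := vcons _ fun _ => q.encode) (i := 0) hsuf).2 ((key _ _ _).2 rfl)⟩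

theorem holds_conforms :
    (conforms K B).Holds q.encode (fun _ => q.encode) ↔ q.Conforms := by
  rw [Instance.Conforms, stronglyConforms_iff, conforms, Fm.holds_disj]
  simp only [List.mem_map, List.mem_range, exists_exists_and_eq_and, Fm.holds_disj,
    Fm.holds_and, holds_parameters, Fm.holds_conj, forall_exists_index, and_imp,
    forall_apply_eq_imp_iff₂]
  constructor
  · rintro ⟨k, -, n, -, ⟨rfl, rfl⟩, h⟩ m hm
    exact (holds_conformsAt m).1 (h m (Nat.lt_succ_of_le hm))
  · intro h
    exact ⟨q.k, Nat.lt_succ_of_le q.k_le, q.n, Nat.lt_succ_of_le q.n_le, ⟨rfl, rfl⟩,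
      fun m hm => (holds_conformsAt m).2 (h m (Nat.le_of_lt_succ hm))⟩

end Correctness

end MultiPort

theorem mainTheorem9 (K B : ℕ) :
    Nonempty (Turing.TM2ComputableInPolyTime
      (MultiPort.Instance.encode (K := K) (B := B))
      Computability.encodeBool
      (MultiPort.Instance.answer (K := K) (B := B))) := by
  refine StackProgram.polyTime_of_formula _ _ (MultiPort.conforms K B) fun q => ?_
  rw [MultiPort.holds_conforms]
  simp [MultiPort.Instance.answer]
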